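/- Let $\theta_c<\theta_e<\theta_c+2\pi$, $z_c=e^{i\theta_c}$, $\mathcal Z=\{e^{i\varphi}:\theta_c\le\varphi\le\theta_e\}$, $\sigma\in(-1,0)$ and $A>0$. Let $\Omega\subset\mathbb C\setminus\mathcal Z$ be open and connected and contain every point of $\mathbb C\setminus\mathcal Z$ sufficiently close to $z_c$. Suppose that $F:\Omega\to\mathbb C$ has the Stieltjes (logarithmic potential) representation $$F(z)-C=\frac1{2\pi}\int_{\theta_c}^{\theta_e}\log\frac{z-e^{i\varphi}}{z_0-e^{i\varphi}}\;\rho(\varphi)\,d\varphi\qquad(z\in\Omega)$$ for some constant $C\in\mathbb C$ (for instance $C=F(z_c)$) and some $z_0\in\Omega$, where $\rho\in L^1(\theta_c,\theta_e)$ is real-valued and, for each $\varphi$, the logarithm is a holomorphic branch on $\Omega$ (assumed to exist) that vanishes at $z=z_0$. Suppose that $$\rho(\theta)=A(\theta-\theta_c)^{\sigma}+O(|\theta-\theta_c|^{\sigma+1})\qquad(\theta\to\theta_c^+).$$ Then the limit $F(z_c):=\lim_{\Omega\ni z\to z_c}F(z)$ exists, and $$F(z)=F(z_c)+B\,(z-z_c)^{\sigma+1}+o(|z-z_c|^{\sigma+1})\qquad(z\to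 z_c,\ z\in\Omega),$$ $$B=\frac{A\,e^{i\pi\sigma/2}\,e^{-i\theta_c(\sigma+1)}}{2i(\sigma+1)\sin(\pi\sigma)}.$$ Here $(z-z_c)^{\sigma+1}=e^{i\theta_c(\sigma+1)}\zeta^{\sigma+1}$ with $\zeta=e^{-i\theta_c}(z-z_c)$, and $\zeta^{\sigma+1}$ is the branch, holomorphic near $z_c$ off the arc $\mathcal Z$, that is positive on the outward normal $\zeta>0$. Explicitly, near $z_c$: $\arg\zeta\in(-\pi,\pi]$ is the principal argument if $|z|\ge1$, and $\arg\zeta\in(-3\pi/2,-\pi/2)$ if $|z|<1$. In particular $|B|=\dfrac{A}{2(\sigma+1)|\sin\pi\sigma|}\neq0$. -/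

import Mathlib

open Filter Topology MeasureTheory Asymptotics

/-- The closed arc `{e^{iφ} : θc ≤ φ ≤ θe}` of the unit circle, on which the zeros accumulate.
Its initial endpoint `e^{iθc}` is the edge. -/
def zeroArc (θc θe : ℝ) : Set ℂ :=
  (fun φ : ℝ => Complex.exp (φ * Complex.I)) '' Set.Icc θc θe

/-- The edge `z_c = e^{iθc}`. -/
noncomputable def edgePoint (θc : ℝ) : ℂ := Complex.exp (θc * Complex.I)

/-- `Ω` is a domain (open, connected) in the complement of the arc that contains all points
off the arc which are close enough to the edge. -/
structure IsEdgeDomain (θc θe : ℝ) (Ω : Set ℂ) : Prop where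
  isOpen : IsOpen Ω
  isConnected : IsConnected Ω
  disjoint_arc : Disjoint Ω (zeroArc θc θe)
  near_edge : ∀ᶠ z in 𝓝[(zeroArc θc θe)ᶜ] (edgePoint θc), z ∈ Ω

/-- `ℓ` is the holomorphic branch on `Ω` of `z ↦ log ((z - a) / (z₀ - a))` that vanishes at
`z₀`. (On a connected open `Ω` that contains `z₀` but not `a` there is at most one.) -/
structure IsLogRatioBranch (Ω : Set ℂ) (z₀ a : ℂ) (ℓ : ℂ → ℂ) : Prop where
  differentiableOn : DifferentiableOn ℂ ℓ Ω
  exp_eq : ∀ z ∈ Ω, Complex.exp (ℓ z) = (z - a) / (z₀ - a)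
  base : ℓ z₀ = 0

/-- The Stieltjes (logarithmic potential) representation on `Ω`, with an `L¹` density `ρ`:
`F z - C = ∫ log ((z - e^{iφ}) / (z₀ - e^{iφ})) ρ(φ) dφ/2π`, the integral being over the arc. -/
def HasStieltjesRep (F : ℂ → ℂ) (C : ℂ) (ρ : ℝ → ℝ) (θc θe : ℝ) (Ω : Set ℂ) : Prop :=
  IntegrableOn ρ (Set.Icc θc θe) ∧
  ∃ z₀ ∈ Ω, ∃ L : ℝ → ℂ → ℂ,
    (∀ φ ∈ Set.Icc θc θe,
      IsLogRatioBranch Ω z₀ (Complex.exp (φ * Complex.I)) (L φ)) ∧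
    ∀ z ∈ Ω, F z - C = (1 / (2 * Real.pi) : ℂ) * ∫ φ in Set.Icc θc θe, L φ z * (ρ φ : ℂ)

/-- The branch of `log (z - z_c)` used at the edge. Put `ζ = e^{-iθc} (z - z_c)`, so that
`log (z - z_c) = iθc + log ζ`. Outside the open unit disc `log ζ` is the principal logarithm;
inside the unit disc, where `Re ζ < 0`, the argument of `ζ` is taken in `(-3π/2, -π/2)`.
The two pieces fit together across `{e^{iθ} : θ < θc}`, so near `z_c` this is the holomorphic
branch whose cut is the arc `{e^{iθ} : θ ≥ θc}` and for which `arg ζ = 0` on the outward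
normal `z = (1 + r) z_c`, `r > 0`. -/
noncomputable def edgeLog (θc : ℝ) (z : ℂ) : ℂ :=
  θc * Complex.I +
    if 1 ≤ ‖z‖ then Complex.log (Complex.exp (-(θc * Complex.I)) * (z - edgePoint θc))
    else Complex.log (-(Complex.exp (-(θc * Complex.I)) * (z - edgePoint θc)))
      - Real.pi * Complex.I

/-- The corresponding branch of the power `(z - z_c)^α`. -/
noncomputable def edgePow (θc α : ℝ) (z : ℂ) : ℂ := Complex.exp (α * edgeLog θc z)

/-- `edgeLog` is a logarithm of `z - z_c`. -/
theorem exp_edgeLog (θc : ℝ) (z : ℂ) (hz : z ≠ edgePoint θc) :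
    Complex.exp (edgeLog θc z) = z - edgePoint θc := by
  have h0 : z - edgePoint θc ≠ 0 := sub_ne_zero.mpr hz
  have h1 : Complex.exp (-(θc * Complex.I)) * (z - edgePoint θc) ≠ 0 :=
    mul_ne_zero (Complex.exp_ne_zero _) h0
  have h2 : Complex.exp (θc * Complex.I) * Complex.exp (-(θc * Complex.I)) = 1 := by
    rw [← Complex.exp_add, add_neg_cancel, Complex.exp_zero]
  unfold edgeLog
  split_ifs
  · rw [Complex.exp_add, Complex.exp_log h1, ← mul_assoc, h2, one_mul]
  · rw [Complex.exp_add, Complex.exp_sub, Complex.exp_log (neg_ne_zero.mpr h1),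
      Complex.exp_pi_mul_I, neg_div_neg_eq, div_one, ← mul_assoc, h2, one_mul]

/-- The edge expansion: `F z = F(z_c) + B (z - z_c)^{σ+1} + o(|z - z_c|^{σ+1})` as `z → z_c`
in `Ω`, with `B ≠ 0` and `σ ∈ (-1, 0)`. As `z_c` lies on the boundary of `Ω`, the value
`F(z_c)` is the boundary value `Fc = lim F(z)`. -/
structure HasEdgeExpansion (F : ℂ → ℂ) (Ω : Set ℂ) (θc σ : ℝ) (Fc B : ℂ) : Prop where
  sigma_mem : σ ∈ Set.Ioo (-1 : ℝ) 0
  coeff_ne_zero : B ≠ 0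
  tendsto_edge : Tendsto F (𝓝[Ω] (edgePoint θc)) (𝓝 Fc)
  expansion : (fun z => F z - Fc - B * edgePow θc (σ + 1) z)
    =o[𝓝[Ω] (edgePoint θc)] fun z => ‖z - edgePoint θc‖ ^ (σ + 1)

/-- The coefficient `A e^{iπσ/2} e^{-iθc(σ+1)} / (2i (σ+1) sin πσ)`. -/
noncomputable def edgeCoeff (A σ θc : ℝ) : ℂ :=
  A * Complex.exp (Complex.I * Real.pi * σ / 2)
      * Complex.exp (-(Complex.I * θc * (σ + 1)))
    / (2 * Complex.I * (σ + 1) * Real.sin (Real.pi * σ))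

/-! In the coordinate `z = z_c e^{-iw}` the edge is `w = 0` and the arc point `z_c e^{it}` is `w =
-t`. Near the edge the complement of the arc thus becomes the slit plane. The kernel factors as
`e^{-iw} - e^{it} = (1 - e^{it}) (1 + w/t) exp E(t, w)`, with `E = O(w)` uniformly in `t`
(`exists_arc_log_remainder`). By connectedness every branch `L φ` equals a constant depending on `t
= φ - θc`, plus `log (1 + w/t) + E(t, w)` (`IsLogRatioBranch.sub_eq_sub_of_model`).

Integrated against `ρ`, the constants and `C` make up `F(z_c)`, and `E` contributes `O(w) =
o(|w|^{σ+1})` because `σ < 0`. For the model kernel, `∫₀^∞ log (1 + w/t) t^σ dt` is homogeneous of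
degree `σ + 1`. By analytic continuation it is `-π w^{σ+1} / ((σ+1) sin πσ)`, where the constant
comes from Euler's Beta integral (`logKernelIntegral_eq_mul_cpow`, `logKernelIntegral_one`).
Truncating at `t = θe - θc` costs `O(w)`. The density error is at most `ε t^σ` close to `0` and
merely integrable elsewhere, so it costs `ε O(|w|^{σ+1}) + O_ε(w)`
(`integral_log_kernel_remainder`).

Finally `e^{-iw} - 1 ~ -iw`, and the chosen branch is `edgeLog = iθc + log w - iπ/2 + o(1)`
(`exists_edgeLog_eq`). This converts `w^{σ+1}` into `edgePow` and produces the phase of `edgeCoeff`.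
-/

/-! ### Branches of the logarithmic kernel. -/

/-- Two holomorphic logarithms of proportional functions differ by a constant. -/
theorem sub_eq_sub_of_exp_eq_mul_exp {U : Set ℂ} (hU : IsOpen U) (hc : IsPreconnected U)
    {f g : ℂ → ℂ} (hf : DifferentiableOn ℂ f U) (hg : DifferentiableOn ℂ g U) {k : ℂ}
    (h : ∀ z ∈ U, Complex.exp (f z) = k * Complex.exp (g z)) {x y : ℂ} (hx : x ∈ U)
    (hy : y ∈ U) : f x - g x = f y - g y := by
  have hd : DifferentiableOn ℂ (fun z => f z - g z) U := hf.sub hg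
  have hk : ∀ z ∈ U, Complex.exp (f z - g z) = k := fun z hz => by
    rw [Complex.exp_sub, h z hz, mul_div_assoc, div_self (Complex.exp_ne_zero _), mul_one]
  refine hU.is_const_of_deriv_eq_zero hc hd (fun z hz => ?_) hx hy
  have h1 := ((hd z hz).differentiableAt (hU.mem_nhds hz)).hasDerivAt
  have h2 := h1.cexp
  have h3 : (fun z => Complex.exp (f z - g z)) =ᶠ[𝓝 z] fun _ => k := by
    filter_upwards [hU.mem_nhds hz] with u hu using hk u hu
  have h4 := h2.unique ((hasDerivAt_const z k).congr_of_eventuallyEq h3)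
  exact (mul_eq_zero.mp h4).resolve_left (Complex.exp_ne_zero _)

/-- Since `a ∉ Ω`, the ball has radius at most `|z - a|`, so the argument of the logarithm stays
within distance 1 of 1. Local increments of a branch are thereby explicit in `a`, which gives
continuity in the pole. -/
theorem IsLogRatioBranch.sub_eq_log {Ω : Set ℂ} {z₀ a : ℂ} {ℓ : ℂ → ℂ}
    (h : IsLogRatioBranch Ω z₀ a ℓ) {z z' : ℂ} {r : ℝ} (hr : Metric.ball z r ⊆ Ω)
    (ha : a ∉ Ω) (hz' : z' ∈ Metric.ball z r) :
    ℓ z' - ℓ z = Complex.log (1 + (z' - z) / (z - a)) := by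
  have hr0 : 0 < r := (dist_nonneg.trans_lt hz')
  have hza : z - a ≠ 0 := sub_ne_zero.mpr fun e => ha (e ▸ hr (Metric.mem_ball_self hr0))
  have har : r ≤ ‖z - a‖ := by
    by_contra! hlt
    exact ha (hr (by rwa [Metric.mem_ball, dist_comm, dist_eq_norm]))
  have hslit : ∀ u ∈ Metric.ball z r, 1 + (u - z) / (z - a) ∈ Complex.slitPlane := by
    intro u hu
    apply Complex.mem_slitPlane_of_norm_lt_one
    rw [norm_div, div_lt_one (norm_pos_iff.mpr hza)]
    rw [Metric.mem_ball, dist_eq_norm] at hu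
    linarith
  have key := sub_eq_sub_of_exp_eq_mul_exp (U := Metric.ball z r) Metric.isOpen_ball
    (convex_ball z r).isPreconnected (f := ℓ)
    (g := fun u => Complex.log (1 + (u - z) / (z - a))) (k := (z - a) / (z₀ - a))
    (h.differentiableOn.mono hr) (fun u hu => by
      refine (DifferentiableAt.clog (f := fun u => 1 + (u - z) / (z - a)) ?_
        (hslit u hu)).differentiableWithinAt
      fun_prop) (fun u hu => by
      rw [h.exp_eq u (hr hu), Complex.exp_log (Complex.slitPlane_ne_zero (hslit u hu))]
      rw [one_add_div hza]
      rw [div_mul_div_comm, mul_comm (z₀ - a), mul_div_mul_left _ _ hza]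
      ring) hz' (Metric.mem_ball_self hr0)
  simp only [sub_self, zero_div, add_zero, Complex.log_one, sub_zero] at key
  linear_combination key

/-- The branches of the logarithmic kernel depend continuously on the position of the pole. -/
theorem continuousOn_logRatioBranch {Ω : Set ℂ} (hΩ : IsOpen Ω) (hc : IsPreconnected Ω)
    {z₀ : ℂ} (hz₀ : z₀ ∈ Ω) {S : Set ℝ} {a : ℝ → ℂ} (ha : ContinuousOn a S)
    (haΩ : ∀ φ ∈ S, a φ ∉ Ω) {L : ℝ → ℂ → ℂ}
    (hL : ∀ φ ∈ S, IsLogRatioBranch Ω z₀ (a φ) (L φ)) {z : ℂ} (hz : z ∈ Ω) :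
    ContinuousOn (fun φ => L φ z) S := by
  have step : ∀ z r z', Metric.ball z r ⊆ Ω → z' ∈ Metric.ball z r →
      ContinuousOn (fun φ => L φ z' - L φ z) S := by
    intro z r z' hr hz'
    have hr0 : 0 < r := (dist_nonneg.trans_lt hz')
    have hza : ∀ φ ∈ S, z - a φ ≠ 0 := fun φ hφ =>
      sub_ne_zero.mpr fun e => haΩ φ hφ (e ▸ hr (Metric.mem_ball_self hr0))
    refine ContinuousOn.congr (f := fun φ => Complex.log (1 + (z' - z) / (z - a φ))) ?_
      fun φ hφ => (hL φ hφ).sub_eq_log hr (haΩ φ hφ) hz'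
    refine ContinuousOn.clog (continuousOn_const.add
      (continuousOn_const.div (continuousOn_const.sub ha) hza)) fun φ hφ => ?_
    apply Complex.mem_slitPlane_of_norm_lt_one
    rw [norm_div, div_lt_one (norm_pos_iff.mpr (hza φ hφ))]
    rw [Metric.mem_ball, dist_eq_norm] at hz'
    refine hz'.trans_le ?_
    by_contra! hlt
    exact haΩ φ hφ (hr (by rwa [Metric.mem_ball, dist_comm, dist_eq_norm]))
  have hbase : ContinuousOn (fun φ => L φ z₀) S :=
    (continuousOn_const (c := (0 : ℂ))).congr fun φ hφ => (hL φ hφ).base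
  -- Continuity of `L φ x - L φ y` in `φ` is an equivalence relation between `x` and `y` that holds
  -- locally by `step`, hence on all of the preconnected `Ω`. The normalization at `z₀` then removes
  -- the second term.
  have := hc.induction₂ (fun x y => ContinuousOn (fun φ => L φ x - L φ y) S) (fun x hx => by
      obtain ⟨r, hr0, hr⟩ := Metric.isOpen_iff.mp hΩ x hx
      filter_upwards [mem_nhdsWithin_of_mem_nhds (Metric.ball_mem_nhds x hr0)] with y hy
      exact (step x r y hr hy).neg.congr fun φ _ => by simp) (fun x y w _ _ _ h1 h2 => by
      exact (h1.add h2).congr fun φ _ => by simp)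
    (fun x y _ _ h => h.neg.congr fun φ _ => by simp) hz hz₀
  exact (this.add hbase).congr fun φ _ => by simp

/-! ### Uniform bounds and scaling for the model kernel. -/

/-- For `s ≤ 2` one has `|s - 1|/s ≤ |1 + u/s| ≤ 3/s`, so the bound does not depend on the direction
`u` and survives up to the cut `u = -1`. The point `s = 1` must be excluded because `Real.log 0 = 0`
hides the singularity there. -/
theorem norm_log_one_add_div_le {u : ℂ} (hu : ‖u‖ = 1) {s : ℝ} (hs : 0 < s) (hs2 : s ≤ 2)
    (hs1 : s ≠ 1) :
    ‖Complex.log (1 + u / s)‖ ≤ Real.pi + Real.log 3 + |Real.log s| + |Real.log (s - 1)| := by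
  set v := 1 + u / s with hv
  have hns : ‖u / (s : ℂ)‖ = 1 / s := by
    rw [norm_div, hu, Complex.norm_real, Real.norm_of_nonneg hs.le]
  have hup : ‖v‖ ≤ 1 + 1 / s := by
    refine (norm_add_le _ _).trans ?_
    rw [hns]; simp
  have hlo : |s - 1| / s ≤ ‖v‖ := by
    have h := abs_norm_sub_norm_le (1 : ℂ) (-(u / s))
    rw [norm_neg, hns, norm_one, sub_neg_eq_add] at h
    refine le_trans (le_of_eq ?_) h
    rw [one_sub_div hs.ne', abs_div, abs_of_pos hs]
  have habs : 0 < |s - 1| := abs_pos.mpr (sub_ne_zero.mpr hs1)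
  have hpos : 0 < ‖v‖ := lt_of_lt_of_le (div_pos habs hs) hlo
  have h1 : Real.log ‖v‖ ≤ Real.log 3 - Real.log s := by
    rw [← Real.log_div (by norm_num) hs.ne']
    refine Real.log_le_log hpos (hup.trans ?_)
    rw [one_add_div hs.ne']
    gcongr
    linarith
  have h2 : Real.log (s - 1) - Real.log s ≤ Real.log ‖v‖ := by
    rw [← Real.log_abs (s - 1), ← Real.log_div habs.ne' hs.ne']
    exact Real.log_le_log (div_pos habs hs) hlo
  have h3 : ‖Complex.log v‖ ≤ |Real.log ‖v‖| + Real.pi := by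
    refine (Complex.norm_le_abs_re_add_abs_im _).trans ?_
    rw [Complex.log_re, Complex.log_im]
    gcongr
    exact Complex.abs_arg_le_pi v
  have hl3 : 0 ≤ Real.log 3 := Real.log_nonneg (by norm_num)
  have h4 : |Real.log ‖v‖| ≤ Real.log 3 + |Real.log s| + |Real.log (s - 1)| := by
    rw [abs_le]
    constructor
    · linarith [neg_abs_le (Real.log (s - 1)), le_abs_self (Real.log s)]
    · linarith [abs_nonneg (Real.log (s - 1)), neg_abs_le (Real.log s)]
  linarith

theorem norm_log_one_add_div_le_div {u : ℂ} {s : ℝ} (hs : 0 < s) (hs2 : 2 * ‖u‖ ≤ s) :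
    ‖Complex.log (1 + u / s)‖ ≤ 3 / 2 * (‖u‖ / s) := by
  have hns : ‖u / (s : ℂ)‖ = ‖u‖ / s := by
    rw [norm_div, Complex.norm_real, Real.norm_of_nonneg hs.le]
  have := Complex.norm_log_one_add_half_le_self (z := u / s) (by
    rw [hns, div_le_iff₀ hs]; linarith)
  rwa [hns] at this

theorem integrableOn_abs_log_mul_rpow {σ : ℝ} (hσ : -1 < σ) (b : ℝ) :
    IntegrableOn (fun s : ℝ => |Real.log s| * s ^ σ) (Set.Ioc 0 b) := by
  -- Half of the available exponent absorbs the logarithm, `|log s| s^κ ≤ 1/κ` on `(0, 1]`, and the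
  -- remaining exponent `σ - κ` still exceeds `-1`.
  set κ := (σ + 1) / 2 with hκ
  have hκ0 : 0 < κ := by rw [hκ]; linarith
  have h1 : IntegrableOn (fun s : ℝ => |Real.log s| * s ^ σ) (Set.Ioc 0 1) := by
    have h2 : IntegrableOn (fun s : ℝ => 1 / κ * s ^ (σ - κ)) (Set.Ioc 0 1) := by
      refine Integrable.const_mul ?_ _
      have := (intervalIntegral.intervalIntegrable_rpow' (a := 0) (b := 1) (r := σ - κ)
        (by rw [hκ]; linarith))
      rwa [intervalIntegrable_iff_integrableOn_Ioc_of_le zero_le_one] at this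
    refine Integrable.mono' h2 (by fun_prop) ?_
    filter_upwards [ae_restrict_mem measurableSet_Ioc] with s hs
    have h3 := (Real.abs_log_mul_self_rpow_lt s κ hs.1 hs.2 hκ0).le
    rw [abs_mul, abs_of_pos (Real.rpow_pos_of_pos hs.1 _)] at h3
    have hp := Real.rpow_nonneg hs.1.le (σ - κ)
    rw [Real.norm_of_nonneg (mul_nonneg (abs_nonneg _) (Real.rpow_nonneg hs.1.le _))]
    calc |Real.log s| * s ^ σ = (|Real.log s| * s ^ κ) * s ^ (σ - κ) := by
          rw [mul_assoc, ← Real.rpow_add hs.1]; congr 2; ring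
      _ ≤ _ := by gcongr
  have h2 : IntegrableOn (fun s : ℝ => |Real.log s| * s ^ σ) (Set.Icc 1 b) := by
    refine ContinuousOn.integrableOn_Icc ?_
    intro s hs
    have hs0 : s ≠ 0 := (zero_lt_one.trans_le hs.1).ne'
    exact ((Real.continuousAt_log hs0).abs.mul
      (Real.continuousAt_rpow_const _ _ (Or.inl hs0))).continuousWithinAt
  refine (h1.union h2).mono_set fun s hs => ?_
  rcases le_total s 1 with h | h
  · exact Or.inl ⟨hs.1, h⟩
  · exact Or.inr ⟨h, hs.2⟩

theorem integrableOn_rpow_Ioc {σ : ℝ} (hσ : -1 < σ) {b : ℝ} (hb : 0 ≤ b) :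
    IntegrableOn (fun s : ℝ => s ^ σ) (Set.Ioc 0 b) := by
  have := (intervalIntegral.intervalIntegrable_rpow' (a := 0) (b := b) hσ)
  rwa [intervalIntegrable_iff_integrableOn_Ioc_of_le hb] at this

theorem integrableOn_abs_log_sub_one_mul_rpow {σ : ℝ} (hσ : -1 < σ) :
    IntegrableOn (fun s : ℝ => |Real.log (s - 1)| * s ^ σ) (Set.Ioc 0 2) := by
  -- Cutting at `1/2` separates the singularity of `s^σ` at 0 from that of the logarithm at 1.
  have h1 : IntegrableOn (fun s : ℝ => s ^ σ * |Real.log (s - 1)|) (Set.Icc 0 (1 / 2)) := by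
    refine IntegrableOn.mul_continuousOn ?_ ?_ isCompact_Icc
    · rw [integrableOn_Icc_iff_integrableOn_Ioc]
      exact integrableOn_rpow_Ioc hσ (by norm_num)
    · refine (ContinuousOn.log (by fun_prop) fun s hs => ?_).abs
      have := hs.2
      intro h; linarith
  have h2 : IntegrableOn (fun s : ℝ => |Real.log (s - 1)| * s ^ σ) (Set.Icc (1 / 2) 2) := by
    refine IntegrableOn.mul_continuousOn ?_ ?_ isCompact_Icc
    · refine Integrable.abs ?_
      have := (intervalIntegral.intervalIntegrable_log' (a := -1/2) (b := 1)).comp_sub_right 1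
      rw [show (-1 / 2 + 1 : ℝ) = 1 / 2 by norm_num, show (1 + 1 : ℝ) = 2 by norm_num,
        intervalIntegrable_iff_integrableOn_Icc_of_le (by norm_num)] at this
      exact this
    · refine ContinuousOn.rpow_const continuousOn_id fun s hs => Or.inl ?_
      have := hs.1
      intro h; linarith
  refine ((h1.congr_fun (fun s _ => mul_comm _ _) measurableSet_Icc).union h2).mono_set
    fun s hs => ?_
  rcases le_total s (1 / 2) with h | h
  · exact Or.inl ⟨hs.1.le, h⟩
  · exact Or.inr ⟨h, hs.2⟩

/-- A dominating function for the logarithmic kernel, uniform in the direction. -/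
theorem exists_integrable_bound_log_kernel {σ : ℝ} (hσ : σ ∈ Set.Ioo (-1 : ℝ) 0) :
    ∃ g : ℝ → ℝ, IntegrableOn g (Set.Ioi 0) ∧ ∀ u : ℂ, ‖u‖ = 1 →
      ∀ᵐ s : ℝ ∂(volume.restrict (Set.Ioi (0 : ℝ))), ‖Complex.log (1 + u / s)‖ * s ^ σ ≤ g s := by
  set g₁ : ℝ → ℝ := fun s => (Real.pi + Real.log 3) * s ^ σ + |Real.log s| * s ^ σ
    + |Real.log (s - 1)| * s ^ σ
  set g₂ : ℝ → ℝ := fun s => 3 / 2 * s ^ (σ - 1)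
  have i₁ : IntegrableOn g₁ (Set.Ioc 0 2) :=
    (((integrableOn_rpow_Ioc hσ.1 (by norm_num)).const_mul _).add
      (integrableOn_abs_log_mul_rpow hσ.1 2)).add (integrableOn_abs_log_sub_one_mul_rpow hσ.1)
  have i₂ : IntegrableOn g₂ (Set.Ioi 2) :=
    (integrableOn_Ioi_rpow_of_lt (by linarith [hσ.2]) (by norm_num)).const_mul _
  refine ⟨fun s => if s ≤ 2 then g₁ s else g₂ s, ?_, fun u hu => ?_⟩
  · rw [← Set.Ioc_union_Ioi_eq_Ioi (zero_le_two (α := ℝ))]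
    refine (i₁.congr_fun (fun s hs => ?_) measurableSet_Ioc).union
      (i₂.congr_fun (fun s hs => ?_) measurableSet_Ioi)
    · exact (if_pos hs.2).symm
    · exact (if_neg (not_le.mpr hs)).symm
  · have hne : ∀ᵐ s ∂(volume.restrict (Set.Ioi (0 : ℝ))), s ≠ 1 :=
      ae_restrict_of_ae (by simp [ae_iff])
    filter_upwards [ae_restrict_mem measurableSet_Ioi, hne] with s hs h1
    have hs0 : 0 < s := hs
    have hp : 0 ≤ s ^ σ := Real.rpow_nonneg hs0.le σ
    split_ifs with h2
    · refine (mul_le_mul_of_nonneg_right (norm_log_one_add_div_le hu hs0 h2 h1) hp).trans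
        (le_of_eq ?_)
      simp only [g₁]; ring
    · have := norm_log_one_add_div_le_div (u := u) hs0 (by rw [hu]; linarith)
      refine (mul_le_mul_of_nonneg_right this hp).trans (le_of_eq ?_)
      simp only [g₂]
      rw [hu, Real.rpow_sub_one hs0.ne']; ring

theorem aestronglyMeasurable_log_kernel (w : ℂ) (σ : ℝ) (S : Set ℝ) :
    AEStronglyMeasurable (fun t : ℝ => Complex.log (1 + w / t) * ((t ^ σ : ℝ) : ℂ))
      (volume.restrict S) :=
  (Measurable.mul (by fun_prop) (by fun_prop)).aestronglyMeasurable

theorem log_kernel_scale {σ : ℝ} (r : ℝ) (hr : 0 < r) (u : ℂ) {s : ℝ} (hs : 0 < s) :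
    Complex.log (1 + ((r : ℂ) * u) / ((r * s : ℝ) : ℂ)) * (((r * s) ^ σ : ℝ) : ℂ)
      = ((r ^ σ : ℝ) : ℂ) * (Complex.log (1 + u / s) * ((s ^ σ : ℝ) : ℂ)) := by
  rw [Real.mul_rpow hr.le hs.le]
  push_cast
  rw [mul_div_mul_left _ _ (by exact_mod_cast hr.ne')]
  ring

/-- The logarithmic kernel is integrable against `t ^ σ`, with the scaling bound. -/
theorem exists_integral_log_kernel_le {σ : ℝ} (hσ : σ ∈ Set.Ioo (-1 : ℝ) 0) :
    ∃ c : ℝ, ∀ w : ℂ, w ≠ 0 →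
      IntegrableOn (fun t : ℝ => Complex.log (1 + w / t) * ((t ^ σ : ℝ) : ℂ)) (Set.Ioi 0) ∧
      ∫ t in Set.Ioi (0 : ℝ), ‖Complex.log (1 + w / t) * ((t ^ σ : ℝ) : ℂ)‖
        ≤ c * ‖w‖ ^ (σ + 1) := by
  obtain ⟨g, hg, hb⟩ := exists_integrable_bound_log_kernel hσ
  refine ⟨∫ s in Set.Ioi (0 : ℝ), g s, fun w hw => ?_⟩
  obtain ⟨r, hr⟩ : ∃ r, r = ‖w‖ := ⟨_, rfl⟩
  rw [← hr]
  have hr0 : 0 < r := hr ▸ norm_pos_iff.mpr hw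
  -- With `w = r u` and `t = r s` the kernel depends only on the direction `u`; the substitution
  -- yields the factor `r · r^σ`.
  obtain ⟨u, hu, rfl⟩ : ∃ u : ℂ, ‖u‖ = 1 ∧ w = (r : ℂ) * u := by
    refine ⟨w / r, ?_, ?_⟩
    · rw [norm_div, Complex.norm_real, Real.norm_of_nonneg hr0.le, ← hr, div_self hr0.ne']
    · rw [mul_div_cancel₀]; exact_mod_cast hr0.ne'
  have hN : ∀ᵐ s : ℝ ∂(volume.restrict (Set.Ioi (0 : ℝ))),
      ‖Complex.log (1 + u / s) * ((s ^ σ : ℝ) : ℂ)‖ ≤ g s := by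
    filter_upwards [hb u hu, ae_restrict_mem measurableSet_Ioi] with s h1 h2
    rwa [norm_mul, Complex.norm_real, Real.norm_of_nonneg (Real.rpow_nonneg (le_of_lt h2) σ)]
  have hi : IntegrableOn (fun s : ℝ => Complex.log (1 + u / s) * ((s ^ σ : ℝ) : ℂ))
      (Set.Ioi 0) :=
    Integrable.mono' hg (aestronglyMeasurable_log_kernel u σ _) hN
  set f : ℝ → ℂ := fun t => Complex.log (1 + (r * u) / t) * ((t ^ σ : ℝ) : ℂ) with hf
  have hfe : ∀ s ∈ Set.Ioi (0 : ℝ), ((r ^ σ : ℝ) : ℂ) *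
      (Complex.log (1 + u / s) * ((s ^ σ : ℝ) : ℂ)) = f (r * s) := fun s hs =>
    (log_kernel_scale r hr0 u hs).symm
  constructor
  · have := (integrableOn_Ioi_comp_mul_left_iff f 0 hr0).mp
      (IntegrableOn.congr_fun (Integrable.const_mul hi _) hfe measurableSet_Ioi)
    simpa using this
  · have h1 : ∫ t in Set.Ioi (0 : ℝ), ‖f t‖ = r * ∫ s in Set.Ioi (0 : ℝ), ‖f (r * s)‖ := by
      have := integral_comp_mul_left_Ioi (fun t => ‖f t‖) 0 hr0
      rw [this, mul_zero, smul_eq_mul, ← mul_assoc, mul_inv_cancel₀ hr0.ne', one_mul]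
    have h2 : ∫ s in Set.Ioi (0 : ℝ), ‖f (r * s)‖
        = r ^ σ * ∫ s in Set.Ioi (0 : ℝ), ‖Complex.log (1 + u / s) * ((s ^ σ : ℝ) : ℂ)‖ := by
      rw [← integral_const_mul]
      refine setIntegral_congr_fun measurableSet_Ioi fun s hs => ?_
      rw [← hfe s hs, norm_mul, Complex.norm_real,
        Real.norm_of_nonneg (Real.rpow_nonneg hr0.le σ)]
    rw [h1, h2, Real.rpow_add_one hr0.ne']
    have h3 := integral_mono_ae hi.norm hg hN
    have h4 := Real.rpow_pos_of_pos hr0 σ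
    calc _ ≤ r * (r ^ σ * ∫ s in Set.Ioi (0 : ℝ), g s) := by gcongr
      _ = _ := by ring

/-! ### Evaluation of the model integral. -/

/-- The Mellin-type transform `∫₀^∞ log (1 + w / t) t ^ σ dt` of the logarithmic kernel. -/
noncomputable def logKernelIntegral (σ : ℝ) (w : ℂ) : ℂ :=
  ∫ t in Set.Ioi (0 : ℝ), Complex.log (1 + w / t) * ((t ^ σ : ℝ) : ℂ)

theorem one_add_div_mem_slitPlane {w : ℂ} (hw : w ∈ Complex.slitPlane) {t : ℝ} (ht : 0 < t) :
    1 + w / t ∈ Complex.slitPlane := by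
  rw [Complex.mem_slitPlane_iff] at hw ⊢
  simp only [Complex.add_re, Complex.one_re, Complex.div_ofReal_re, Complex.add_im,
    Complex.one_im, Complex.div_ofReal_im, zero_add]
  rcases hw with h | h
  · left; positivity
  · right; exact div_ne_zero h ht.ne'

/-- The quotient `(t + w)/(1 + t)` is a convex combination of `1` and `w`, and the slit plane is
star-shaped about `1`. Using `t/(1 + t) ∈ [0, 1]` as parameter makes the problem compact. The bound
dominates the derivative of the kernel near `w₀`. -/
theorem exists_lower_bound_norm_add {w₀ : ℂ} (hw₀ : w₀ ∈ Complex.slitPlane) :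
    ∃ r > 0, ∃ c > 0, ∀ w ∈ Metric.ball w₀ r, w ∈ Complex.slitPlane ∧
      ∀ t : ℝ, 0 < t → c * (1 + t) ≤ ‖(t : ℂ) + w‖ := by
  obtain ⟨r, hr0, hr⟩ := Metric.nhds_basis_closedBall.mem_iff.mp
    (Complex.isOpen_slitPlane.mem_nhds hw₀)
  have hK : IsCompact (Set.Icc (0 : ℝ) 1 ×ˢ Metric.closedBall w₀ r) :=
    isCompact_Icc.prod (isCompact_closedBall _ _)
  have hcont : Continuous fun p : ℝ × ℂ => ‖(p.1 : ℂ) + ((1 - p.1 : ℝ) : ℂ) * p.2‖ := by fun_prop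
  obtain ⟨p, hp, hmin⟩ := hK.exists_isMinOn
    ⟨(0, w₀), ⟨by simp, Metric.mem_closedBall_self hr0.le⟩⟩ hcont.continuousOn
  have hmem : (p.1 : ℂ) + ((1 - p.1 : ℝ) : ℂ) * p.2 ∈ Complex.slitPlane := by
    have := Complex.starConvex_one_slitPlane (hr hp.2) hp.1.1 (sub_nonneg.mpr hp.1.2)
      (by ring : p.1 + (1 - p.1) = 1)
    simpa using! this
  refine ⟨r, hr0, _, norm_pos_iff.mpr (Complex.slitPlane_ne_zero hmem), fun w hw =>
    ⟨hr (Metric.ball_subset_closedBall hw), fun t ht => ?_⟩⟩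
  have h1t : 0 < 1 + t := by linarith
  have h := hmin (show (t / (1 + t), w) ∈ Set.Icc (0 : ℝ) 1 ×ˢ Metric.closedBall w₀ r from
    ⟨⟨by positivity, (div_le_one h1t).mpr (by linarith)⟩, Metric.ball_subset_closedBall hw⟩)
  simp only [Set.mem_ofPred_eq] at h
  refine (mul_le_mul_of_nonneg_right h h1t.le).trans (le_of_eq ?_)
  have h1c : (1 + t : ℂ) ≠ 0 := by exact_mod_cast h1t.ne'
  rw [show (t : ℂ) + w = ((t / (1 + t) : ℝ) + ((1 - t / (1 + t) : ℝ) : ℂ) * w) * ((1 + t : ℝ) : ℂ)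
    by push_cast; field_simp; ring, norm_mul, Complex.norm_real, Real.norm_of_nonneg h1t.le]

theorem integrableOn_rpow_div_one_add {σ : ℝ} (hσ : σ ∈ Set.Ioo (-1 : ℝ) 0) :
    IntegrableOn (fun t : ℝ => t ^ σ / (1 + t)) (Set.Ioi 0) := by
  rw [← Set.Ioc_union_Ioi_eq_Ioi (zero_le_one (α := ℝ))]
  refine IntegrableOn.union ?_ ?_
  · refine Integrable.mono' (integrableOn_rpow_Ioc hσ.1 zero_le_one)
      (Measurable.aestronglyMeasurable (by fun_prop)) ?_
    filter_upwards [ae_restrict_mem measurableSet_Ioc] with t ht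
    have h0 : 0 ≤ t ^ σ := Real.rpow_nonneg ht.1.le σ
    rw [Real.norm_of_nonneg (div_nonneg h0 (by linarith [ht.1]))]
    exact div_le_self h0 (by linarith [ht.1])
  · refine Integrable.mono' (integrableOn_Ioi_rpow_of_lt (a := σ - 1) (by linarith [hσ.2])
      zero_lt_one) (Measurable.aestronglyMeasurable (by fun_prop)) ?_
    filter_upwards [ae_restrict_mem measurableSet_Ioi] with t ht
    have ht0 : 0 < t := zero_lt_one.trans ht
    have h0 : 0 ≤ t ^ σ := Real.rpow_nonneg ht0.le σ
    rw [Real.norm_of_nonneg (div_nonneg h0 (by linarith)), Real.rpow_sub_one ht0.ne']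
    exact div_le_div_of_nonneg_left h0 ht0 (by linarith)

theorem hasDerivAt_logKernelIntegral {σ : ℝ} (hσ : σ ∈ Set.Ioo (-1 : ℝ) 0) {w₀ : ℂ}
    (hw₀ : w₀ ∈ Complex.slitPlane) :
    HasDerivAt (logKernelIntegral σ)
      (∫ t in Set.Ioi (0 : ℝ), ((t : ℂ) + w₀)⁻¹ * ((t ^ σ : ℝ) : ℂ)) w₀ := by
  obtain ⟨r, hr0, c, hc0, hb⟩ := exists_lower_bound_norm_add hw₀
  obtain ⟨_, hI⟩ := exists_integral_log_kernel_le hσ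
  refine (hasDerivAt_integral_of_dominated_loc_of_deriv_le
    (F := fun w (t : ℝ) => Complex.log (1 + w / t) * ((t ^ σ : ℝ) : ℂ))
    (F' := fun w (t : ℝ) => ((t : ℂ) + w)⁻¹ * ((t ^ σ : ℝ) : ℂ))
    (bound := fun t => c⁻¹ * (t ^ σ / (1 + t)))
    (Metric.ball_mem_nhds w₀ hr0) (Eventually.of_forall fun w =>
      aestronglyMeasurable_log_kernel w σ _) (hI w₀ (Complex.slitPlane_ne_zero hw₀)).1
    (Measurable.aestronglyMeasurable (by fun_prop)) ?_
    ((integrableOn_rpow_div_one_add hσ).const_mul _) ?_).2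
  · filter_upwards [ae_restrict_mem measurableSet_Ioi] with t ht w hw
    have ht0 : 0 < t := ht
    have h0 : 0 ≤ t ^ σ := Real.rpow_nonneg ht0.le σ
    rw [norm_mul, norm_inv, Complex.norm_real, Real.norm_of_nonneg h0]
    calc ‖(t : ℂ) + w‖⁻¹ * t ^ σ ≤ (c * (1 + t))⁻¹ * t ^ σ := by
          gcongr
          exact (hb w hw).2 t ht0
      _ = _ := by rw [mul_inv]; ring
  · filter_upwards [ae_restrict_mem measurableSet_Ioi] with t ht w hw
    have ht0 : (0 : ℝ) < t := ht
    have htc : (t : ℂ) ≠ 0 := by exact_mod_cast ht0.ne'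
    have hs := one_add_div_mem_slitPlane (hb w hw).1 ht0
    have h1 : HasDerivAt (fun w : ℂ => 1 + w / t) (1 / t) w :=
      ((hasDerivAt_id w).div_const _).const_add _
    have h2 := (h1.clog hs).mul_const ((t ^ σ : ℝ) : ℂ)
    have he : (1 : ℂ) / t / (1 + w / t) = ((t : ℂ) + w)⁻¹ := by
      rw [one_add_div htc, div_div_div_cancel_right₀ htc, one_div]
    rw [he] at h2
    exact h2

theorem logKernelIntegral_ofReal {σ : ℝ} {r : ℝ} (hr : 0 < r) :
    logKernelIntegral σ r = logKernelIntegral σ 1 * (r : ℂ) ^ ((σ + 1 : ℝ) : ℂ) := by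
  unfold logKernelIntegral
  have h := integral_comp_mul_left_Ioi
    (fun t : ℝ => Complex.log (1 + (r : ℂ) / t) * ((t ^ σ : ℝ) : ℂ)) 0 hr
  have h1 : ∫ s in Set.Ioi (0 : ℝ), Complex.log (1 + (r : ℂ) / ((r * s : ℝ) : ℂ))
        * (((r * s) ^ σ : ℝ) : ℂ)
      = ((r ^ σ : ℝ) : ℂ) * ∫ s in Set.Ioi (0 : ℝ), Complex.log (1 + 1 / s)
        * ((s ^ σ : ℝ) : ℂ) := by
    rw [← integral_const_mul]
    refine setIntegral_congr_fun measurableSet_Ioi fun s hs => ?_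
    simpa using log_kernel_scale r hr 1 hs
  rw [h1, mul_zero] at h
  rw [← Complex.ofReal_cpow hr.le, Real.rpow_add_one hr.ne']
  have hrc : (r : ℂ) ≠ 0 := by exact_mod_cast hr.ne'
  rw [Complex.real_smul, Complex.ofReal_inv, eq_inv_mul_iff_mul_eq₀ hrc] at h
  rw [← h]; push_cast; ring

/-- Both sides are holomorphic on the slit plane and agree on the positive reals by scaling; the
identity theorem does the rest. -/
theorem logKernelIntegral_eq_mul_cpow {σ : ℝ} (hσ : σ ∈ Set.Ioo (-1 : ℝ) 0) {w : ℂ}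
    (hw : w ∈ Complex.slitPlane) :
    logKernelIntegral σ w = logKernelIntegral σ 1 * w ^ ((σ + 1 : ℝ) : ℂ) := by
  have h1 : AnalyticOnNhd ℂ (logKernelIntegral σ) Complex.slitPlane :=
    DifferentiableOn.analyticOnNhd (fun w hw =>
      (hasDerivAt_logKernelIntegral hσ hw).differentiableAt.differentiableWithinAt)
      Complex.isOpen_slitPlane
  have h2 : AnalyticOnNhd ℂ (fun w : ℂ => logKernelIntegral σ 1 * w ^ ((σ + 1 : ℝ) : ℂ))
      Complex.slitPlane :=
    DifferentiableOn.analyticOnNhd (fun w hw => ((DifferentiableAt.cpow_const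
      differentiableAt_id hw).const_mul _).differentiableWithinAt) Complex.isOpen_slitPlane
  refine h1.eqOn_of_preconnected_of_frequently_eq h2
    ((Complex.starConvex_one_slitPlane.isPathConnected
      Complex.one_mem_slitPlane).isConnected.isPreconnected)
    Complex.one_mem_slitPlane ?_ hw
  have ht : Tendsto (fun x : ℝ => (x : ℂ)) (𝓝[≠] 1) (𝓝[≠] 1) := by
    refine tendsto_nhdsWithin_of_tendsto_nhds_of_eventually_within _ ?_ ?_
    · exact_mod_cast (Complex.continuous_ofReal.tendsto 1).mono_left nhdsWithin_le_nhds
    · filter_upwards [self_mem_nhdsWithin] with x hx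
      simpa using! hx
  refine ht.frequently (Eventually.frequently ?_)
  filter_upwards [mem_nhdsWithin_of_mem_nhds (Ioi_mem_nhds (zero_lt_one (α := ℝ)))] with x hx
  exact logKernelIntegral_ofReal hx

/-- Euler's integral `∫₀^∞ t ^ σ / (1 + t) dt`. -/
theorem integral_inv_add_one_mul_rpow {σ : ℝ} (hσ : σ ∈ Set.Ioo (-1 : ℝ) 0) :
    ∫ t in Set.Ioi (0 : ℝ), ((t : ℂ) + 1)⁻¹ * ((t ^ σ : ℝ) : ℂ)
      = -(Real.pi / Real.sin (Real.pi * σ) : ℂ) := by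
  -- The substitution `t = x/(1 - x)` turns the integral into the Beta integral `B(σ + 1, -σ)`, to
  -- which the reflection formula applies.
  have himg : (fun x : ℝ => x / (1 - x)) '' Set.Ioo 0 1 = Set.Ioi 0 := by
    ext t
    constructor
    · rintro ⟨x, hx, rfl⟩
      exact div_pos hx.1 (sub_pos.mpr hx.2)
    · intro ht
      have ht0 : (0 : ℝ) < t := ht
      refine ⟨t / (1 + t), ⟨by positivity, (div_lt_one (by positivity)).mpr (by linarith)⟩, ?_⟩
      have : 1 + t ≠ 0 := by positivity
      field_simp
      ring
  have hinj : Set.InjOn (fun x : ℝ => x / (1 - x)) (Set.Ioo 0 1) := by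
    intro x hx y hy h
    have h1 : 1 - x ≠ 0 := (sub_pos.mpr hx.2).ne'
    have h2 : 1 - y ≠ 0 := (sub_pos.mpr hy.2).ne'
    simp only at h
    rw [div_eq_div_iff h1 h2] at h
    linarith
  have hder : ∀ x ∈ Set.Ioo (0 : ℝ) 1, HasDerivWithinAt (fun x : ℝ => x / (1 - x))
      (1 / (1 - x) ^ 2) (Set.Ioo 0 1) x := by
    intro x hx
    have h1 : 1 - x ≠ 0 := (sub_pos.mpr hx.2).ne'
    have := ((hasDerivAt_id x).div ((hasDerivAt_id x).const_sub 1) h1).hasDerivWithinAt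
      (s := Set.Ioo 0 1)
    refine HasDerivWithinAt.congr_deriv this ?_
    simp
  rw [← himg, integral_image_eq_integral_abs_deriv_smul measurableSet_Ioo hder hinj]
  have hbeta : ∫ x in Set.Ioo (0 : ℝ) 1, |1 / (1 - x) ^ 2| •
      ((((x / (1 - x) : ℝ) : ℂ) + 1)⁻¹ * (((x / (1 - x)) ^ σ : ℝ) : ℂ))
      = Complex.betaIntegral ((σ + 1 : ℝ) : ℂ) ((-σ : ℝ) : ℂ) := by
    rw [Complex.betaIntegral, intervalIntegral.integral_of_le zero_le_one,
      integral_Ioc_eq_integral_Ioo]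
    refine setIntegral_congr_fun measurableSet_Ioo fun x hx => ?_
    have h1 : 0 < 1 - x := sub_pos.mpr hx.2
    have e1 : (x : ℂ) ^ (((σ + 1 : ℝ) : ℂ) - 1) = ((x ^ σ : ℝ) : ℂ) := by
      rw [Complex.ofReal_cpow hx.1.le]; congr 1; push_cast; ring
    have e2 : (1 - x : ℂ) ^ (((-σ : ℝ) : ℂ) - 1) = (((1 - x) ^ (-σ - 1) : ℝ) : ℂ) := by
      rw [Complex.ofReal_cpow h1.le]; push_cast; rfl
    rw [e1, e2, Complex.real_smul, abs_of_pos (by positivity), Real.div_rpow hx.1.le h1.le,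
      Real.rpow_sub_one h1.ne', Real.rpow_neg h1.le, ← Complex.ofReal_one, ← Complex.ofReal_add,
      ← Complex.ofReal_inv, ← Complex.ofReal_mul, ← Complex.ofReal_mul, ← Complex.ofReal_mul,
      div_add_one h1.ne']
    congr 1
    have := (Real.rpow_pos_of_pos h1 σ).ne'
    field_simp
    ring
  have hs := hσ.1
  have hs' := hσ.2
  rw [hbeta, Complex.betaIntegral_eq_Gamma_mul_div _ _ (by simpa using by linarith)
    (by simpa using hs'), ← Complex.ofReal_add, show σ + 1 + -σ = 1 by ring, Complex.ofReal_one,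
    Complex.Gamma_one, div_one, show ((-σ : ℝ) : ℂ) = 1 - ((σ + 1 : ℝ) : ℂ) by push_cast; ring,
    Complex.Gamma_mul_Gamma_one_sub]
  rw [show (Real.pi : ℂ) * ((σ + 1 : ℝ) : ℂ) = Real.pi * σ + Real.pi by push_cast; ring,
    Complex.sin_add_pi, div_neg]
  push_cast
  rfl

/-- Differentiating the power law at `w = 1` gives `σ + 1` times the unknown constant, while
differentiating under the integral gives Euler's integral. -/
theorem logKernelIntegral_one {σ : ℝ} (hσ : σ ∈ Set.Ioo (-1 : ℝ) 0) :
    logKernelIntegral σ 1 = -(Real.pi / ((σ + 1) * Real.sin (Real.pi * σ)) : ℂ) := by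
  have h1 := hasDerivAt_logKernelIntegral hσ Complex.one_mem_slitPlane
  have h2 : HasDerivAt (fun w : ℂ => logKernelIntegral σ 1 * w ^ ((σ + 1 : ℝ) : ℂ))
      (logKernelIntegral σ 1 * ((σ + 1 : ℝ) : ℂ)) 1 := by
    have := ((hasDerivAt_id (1 : ℂ)).cpow_const (c := ((σ + 1 : ℝ) : ℂ))
      Complex.one_mem_slitPlane).const_mul (logKernelIntegral σ 1)
    simpa using! this
  have h3 : logKernelIntegral σ =ᶠ[𝓝 1]
      fun w : ℂ => logKernelIntegral σ 1 * w ^ ((σ + 1 : ℝ) : ℂ) := by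
    filter_upwards [Complex.isOpen_slitPlane.mem_nhds Complex.one_mem_slitPlane] with w hw
      using logKernelIntegral_eq_mul_cpow hσ hw
  have h4 := h1.unique (h2.congr_of_eventuallyEq h3)
  rw [integral_inv_add_one_mul_rpow hσ] at h4
  have hne : ((σ + 1 : ℝ) : ℂ) ≠ 0 := by
    exact_mod_cast (by linarith [hσ.1] : (0 : ℝ) < σ + 1).ne'
  rw [eq_comm, ← eq_div_iff hne] at h4
  rw [h4, neg_div, div_div, mul_comm]
  push_cast
  rfl

/-! ### Local coordinate at the edge: kernel remainder and branch of the logarithm. -/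

/-- Dividing out the zero at `u = 0` allows quotients of `1 - e^{iu}` to be handled uniformly down
to `t = 0`. -/
theorem exists_entire_one_sub_exp_eq_mul :
    ∃ G : ℂ → ℂ, Differentiable ℂ G ∧ G 0 = -Complex.I ∧
      ∀ u, 1 - Complex.exp (u * Complex.I) = u * G u := by
  set f : ℂ → ℂ := fun u => 1 - Complex.exp (u * Complex.I) with hf
  have hd : Differentiable ℂ f := by fun_prop
  refine ⟨dslope f 0, ?_, ?_, fun u => ?_⟩
  · rw [← differentiableOn_univ, Complex.differentiableOn_dslope univ_mem]
    exact hd.differentiableOn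
  · rw [dslope_same]
    have : HasDerivAt f (-(Complex.exp (0 * Complex.I) * (1 * Complex.I))) 0 :=
      (((hasDerivAt_id (0 : ℂ)).mul_const Complex.I).cexp).const_sub 1
    rw [this.deriv]; simp
  · have := sub_smul_dslope f 0 u
    simp only [sub_zero, smul_eq_mul] at this
    rw [this]; simp [hf]

theorem mem_slitPlane_of_norm_sub_one_lt_one {q : ℂ} (h : ‖q - 1‖ < 1) : q ∈ Complex.slitPlane := by
  have := Complex.mem_slitPlane_of_norm_lt_one h
  simpa using this

theorem exp_ofReal_mul_I_ne_one {t : ℝ} (h0 : 0 < t) (h1 : t < 2 * Real.pi) :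
    Complex.exp (t * Complex.I) ≠ 1 := by
  intro h
  have hc : Real.cos t = 1 := by
    have := congrArg Complex.re h
    rwa [Complex.exp_ofReal_mul_I_re, Complex.one_re] at this
  have := (Real.cos_eq_one_iff_of_lt_of_lt (by linarith) h1).mp hc
  exact h0.ne' this

/-- In the coordinate `z = z_c e^{-iw}` the kernel `log ((z - a) / (z_c - a))`, `a = z_c e^{it}`,
is `log (1 + w / t)` up to a holomorphic remainder that is `O(w)` uniformly in `t`. -/
theorem exists_arc_log_remainder {b : ℝ} (hb : b < 2 * Real.pi) :
    ∃ E : ℝ → ℂ → ℂ, ∃ r > 0, ∃ M : ℝ,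
      (∀ t ∈ Set.Icc 0 b, DifferentiableOn ℂ (E t) (Metric.ball 0 r)) ∧
      (∀ w ∈ Metric.ball 0 r, ContinuousOn (fun t => E t w) (Set.Icc 0 b)) ∧
      (∀ t ∈ Set.Icc 0 b, ∀ w ∈ Metric.ball 0 r, ‖E t w‖ ≤ M * ‖w‖) ∧
      (∀ t ∈ Set.Ioc 0 b, ∀ w ∈ Metric.ball 0 r,
        Complex.exp (-(w * Complex.I)) - Complex.exp (t * Complex.I)
          = (1 - Complex.exp (t * Complex.I)) * (1 + w / t) * Complex.exp (E t w)) := by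
  obtain ⟨G, hG, hG0, hGm⟩ := exists_entire_one_sub_exp_eq_mul
  have hGne : ∀ t ∈ Set.Icc 0 b, G (t : ℂ) ≠ 0 := by
    intro t ht h
    rcases ht.1.eq_or_lt with h0 | h0
    · rw [← h0, Complex.ofReal_zero, hG0] at h
      exact Complex.I_ne_zero (neg_eq_zero.mp h)
    · have := hGm t
      rw [h, mul_zero, sub_eq_zero] at this
      exact exp_ofReal_mul_I_ne_one h0 (ht.2.trans_lt hb) this.symm
  -- `P t w` is `(e^{-iw} - e^{it}) / ((1 - e^{it}) (1 + w/t))` with its singularities removed; `E`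
  -- will be its principal logarithm.
  set P : ℝ → ℂ → ℂ := fun t w => Complex.exp (-(w * Complex.I)) * G (t + w) / G t with hP
  have hPd : ∀ t, Differentiable ℂ (P t) := fun t => by
    have : Differentiable ℂ fun w : ℂ => G (t + w) :=
      hG.comp (differentiable_id.const_add (t : ℂ))
    simp only [hP]; fun_prop
  have hPder : ∀ t w, deriv (P t) w = (Complex.exp (-(w * Complex.I)) * (-Complex.I) * G (t + w)
      + Complex.exp (-(w * Complex.I)) * deriv G (t + w)) / G t := by
    intro t w
    have h1 : HasDerivAt (fun w : ℂ => Complex.exp (-(w * Complex.I)))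
        (Complex.exp (-(w * Complex.I)) * (-(1 * Complex.I))) w :=
      ((hasDerivAt_id w).mul_const Complex.I).neg.cexp
    have h2 : HasDerivAt (fun w : ℂ => G (t + w)) (deriv G (t + w)) w :=
      (hG (t + w)).hasDerivAt.comp_const_add (t : ℂ) w
    rw [one_mul] at h1
    exact ((h1.mul h2).div_const (G t)).deriv
  have hGc : Continuous G := hG.continuous
  have hG'c : Continuous (deriv G) :=
    (hG.contDiff (n := 1)).continuous_deriv le_rfl
  have hK : IsCompact (Set.Icc (0 : ℝ) b ×ˢ Metric.closedBall (0 : ℂ) 1) :=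
    isCompact_Icc.prod (isCompact_closedBall _ _)
  obtain ⟨M, hM⟩ := hK.exists_bound_of_continuousOn
    (f := fun p : ℝ × ℂ => deriv (P p.1) p.2) (by
      simp only [hPder]
      refine ContinuousOn.div (Continuous.continuousOn (by fun_prop))
        (Continuous.continuousOn (by fun_prop)) fun p hp => hGne _ hp.1)
  have hlip : ∀ t ∈ Set.Icc 0 b, ∀ w ∈ Metric.closedBall (0 : ℂ) 1, ‖P t w - 1‖ ≤ M * ‖w‖ := by
    intro t ht w hw
    have h0 : P t 0 = 1 := by simp [hP, div_self (hGne t ht)]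
    have := (convex_closedBall (0 : ℂ) 1).norm_image_sub_le_of_norm_deriv_le
      (f := P t) (C := M) (fun x _ => hPd t x) (fun x hx => hM (t, x) ⟨ht, hx⟩)
      (Metric.mem_closedBall_self zero_le_one) hw
    rwa [h0, sub_zero] at this
  -- The maximum with 1 keeps the radius `1/(2M')` positive and at most `1/2`, so the ball lies in
  -- the unit disc and `|P - 1| ≤ 1/2` on it.
  set M' := max M 1 with hM'
  have hM'1 : 1 ≤ M' := le_max_right _ _
  have hM'0 : 0 < M' := by linarith
  have hball : ∀ w ∈ Metric.ball (0 : ℂ) (1 / (2 * M')), w ∈ Metric.closedBall (0 : ℂ) 1 ∧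
      M' * ‖w‖ ≤ 1 / 2 := by
    intro w hw
    rw [mem_ball_zero_iff, lt_div_iff₀ (by positivity)] at hw
    rw [mem_closedBall_zero_iff]
    constructor <;> nlinarith [norm_nonneg w]
  have hq : ∀ t ∈ Set.Icc 0 b, ∀ w ∈ Metric.ball (0 : ℂ) (1 / (2 * M')),
      ‖P t w - 1‖ ≤ M' * ‖w‖ := fun t ht w hw =>
    (hlip t ht w (hball w hw).1).trans
      (mul_le_mul_of_nonneg_right (le_max_left _ _) (norm_nonneg _))
  have hslit : ∀ t ∈ Set.Icc 0 b, ∀ w ∈ Metric.ball (0 : ℂ) (1 / (2 * M')),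
      P t w ∈ Complex.slitPlane := fun t ht w hw =>
    mem_slitPlane_of_norm_sub_one_lt_one (by linarith [hq t ht w hw, (hball w hw).2])
  refine ⟨fun t w => Complex.log (P t w), 1 / (2 * M'), by positivity, 3 / 2 * M',
    fun t ht w hw => ?_, fun w hw => ?_, fun t ht w hw => ?_, fun t ht w hw => ?_⟩
  · exact ((hPd t w).clog (hslit t ht w hw)).differentiableWithinAt
  · refine ContinuousOn.clog ?_ fun t ht => hslit t ht w hw
    exact ContinuousOn.div (Continuous.continuousOn (by fun_prop))
      (Continuous.continuousOn (by fun_prop)) hGne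
  · have h1 := hq t ht w hw
    have := Complex.norm_log_one_add_half_le_self (z := P t w - 1)
      (h1.trans (hball w hw).2)
    rw [add_sub_cancel] at this
    linarith
  · have ht' : t ∈ Set.Icc 0 b := Set.Ioc_subset_Icc_self ht
    have htc : (t : ℂ) ≠ 0 := by exact_mod_cast ht.1.ne'
    rw [Complex.exp_log (Complex.slitPlane_ne_zero (hslit t ht' w hw)), hGm t]
    have h1 := hGm (t + w)
    have h2 : Complex.exp (-(w * Complex.I)) * Complex.exp ((t + w) * Complex.I)
        = Complex.exp (t * Complex.I) := by rw [← Complex.exp_add]; congr 1; ring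
    have h3 : (t : ℂ) * G t * (1 + w / t) * P t w
        = Complex.exp (-(w * Complex.I)) * ((t + w) * G (t + w)) := by
      have := hGne t ht'
      simp only [hP]
      field_simp
    rw [h3, ← h1, mul_sub, h2, mul_one]

/-- The branch `edgeLog` in the coordinate `z = z_c e^{-iw}`. -/
theorem exists_edgeLog_eq (θc : ℝ) :
    ∃ lam : ℂ → ℂ, Tendsto lam (𝓝 0) (𝓝 0) ∧ ∀ᶠ w in 𝓝 (0 : ℂ), w ∈ Complex.slitPlane →
      edgeLog θc (edgePoint θc * Complex.exp (-(w * Complex.I)))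
        = θc * Complex.I + (Complex.log w - Real.pi / 2 * Complex.I + lam w) := by
  obtain ⟨G, hG, hG0, hGm⟩ := exists_entire_one_sub_exp_eq_mul
  -- Here `e^{-iw} - 1 = (-iw) · (i G(-w))`, and the last factor tends to 1; its logarithm is `lam`.
  have hc : ContinuousAt (fun w : ℂ => Complex.I * G (-w)) 0 :=
    (continuous_const.mul (hG.continuous.comp continuous_neg)).continuousAt
  have hv : Complex.I * G (-0) = 1 := by simp [hG0]
  have hlam : Tendsto (fun w : ℂ => Complex.log (Complex.I * G (-w))) (𝓝 0) (𝓝 0) := by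
    have := (ContinuousAt.clog hc (by rw [hv]; exact Complex.one_mem_slitPlane)).tendsto
    rwa [hv, Complex.log_one] at this
  refine ⟨_, hlam, ?_⟩
  have hsm : ∀ᶠ w in 𝓝 (0 : ℂ), ‖Complex.log (Complex.I * G (-w))‖ < Real.pi / 2 := by
    have := hlam.norm
    rw [norm_zero] at this
    exact this.eventually_lt_const (by positivity)
  have hne : ∀ᶠ w in 𝓝 (0 : ℂ), Complex.I * G (-w) ≠ 0 :=
    hc.eventually_ne (by rw [hv]; exact one_ne_zero)
  filter_upwards [hsm, hne] with w hw1 hw2 hw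
  set l := Complex.log (Complex.I * G (-w)) with hl
  have hw0 : w ≠ 0 := Complex.slitPlane_ne_zero hw
  have him : |l.im| < Real.pi / 2 := (Complex.abs_im_le_norm l).trans_lt hw1
  rw [abs_lt] at him
  have hexp : Complex.exp (-(w * Complex.I)) - 1 = -Complex.I * w * Complex.exp l := by
    rw [hl, Complex.exp_log hw2]
    have := hGm (-w)
    rw [neg_mul] at this
    linear_combination -this + w * G (-w) * Complex.I_mul_I
  have hζ : Complex.exp (-(θc * Complex.I)) *
      (edgePoint θc * Complex.exp (-(w * Complex.I)) - edgePoint θc)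
      = -Complex.I * w * Complex.exp l := by
    rw [← hexp, edgePoint, ← mul_sub_one, ← mul_assoc, ← Complex.exp_add, neg_add_cancel,
      Complex.exp_zero, one_mul]
  have hnorm : ‖edgePoint θc * Complex.exp (-(w * Complex.I))‖ = Real.exp w.im := by
    rw [norm_mul, edgePoint, Complex.norm_exp_ofReal_mul_I, one_mul, Complex.norm_exp]
    simp
  have hargpi := Complex.neg_pi_lt_arg w
  have harg : w.arg < Real.pi := lt_of_le_of_ne (Complex.arg_le_pi w)
    (Complex.mem_slitPlane_iff_arg.mp hw).1
  have hpi : Complex.exp (Real.pi / 2 * Complex.I) = Complex.I := Complex.exp_pi_div_two_mul_I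
  unfold edgeLog
  rw [hζ, hnorm]
  congr 1
  -- As `|z| = e^{Im w}`, the two cases are `Im w ≥ 0` and `Im w < 0`. In each, the shifted argument
  -- `arg w ∓ π/2` lies in `[-π/2, π/2]`, so a correction below `π/2` keeps it in the principal
  -- range.
  split_ifs with h
  · have h0 : 0 ≤ w.arg := Complex.arg_nonneg_iff.mpr (by simpa using h)
    have he : -Complex.I * w * Complex.exp l
        = Complex.exp (Complex.log w - Real.pi / 2 * Complex.I + l) := by
      rw [Complex.exp_add, Complex.exp_sub, Complex.exp_log hw0, hpi, Complex.div_I]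
      ring
    have hi : (Complex.log w - Real.pi / 2 * Complex.I + l).im
        = w.arg - Real.pi / 2 + l.im := by
      rw [show (Real.pi / 2 * Complex.I : ℂ) = ((Real.pi / 2 : ℝ) : ℂ) * Complex.I by push_cast; rfl]
      rw [Complex.add_im, Complex.sub_im, Complex.log_im, Complex.im_ofReal_mul, Complex.I_im]
      ring
    rw [he, Complex.log_exp (by rw [hi]; linarith) (by rw [hi]; linarith)]
  · have h0 : w.arg < 0 := Complex.arg_neg_iff.mpr (by simpa using h)
    have he : -(-Complex.I * w * Complex.exp l)
        = Complex.exp (Complex.log w + Real.pi / 2 * Complex.I + l) := by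
      rw [Complex.exp_add, Complex.exp_add, Complex.exp_log hw0, hpi]
      ring
    have hi : (Complex.log w + Real.pi / 2 * Complex.I + l).im
        = w.arg + Real.pi / 2 + l.im := by
      rw [show (Real.pi / 2 * Complex.I : ℂ) = ((Real.pi / 2 : ℝ) : ℂ) * Complex.I by push_cast; rfl]
      rw [Complex.add_im, Complex.add_im, Complex.log_im, Complex.im_ofReal_mul, Complex.I_im]
      ring
    rw [he, Complex.log_exp (by rw [hi]; linarith) (by rw [hi]; linarith)]
    ring

/-! ### Asymptotics of the model transform. -/

theorem isLittleO_norm_rpow {σ : ℝ} (hσ : σ ∈ Set.Ioo (-1 : ℝ) 0) (S : Set ℂ) :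
    (fun w : ℂ => ‖w‖) =o[𝓝[S] 0] fun w => ‖w‖ ^ (σ + 1) := by
  have h1 : Tendsto (fun w : ℂ => ‖w‖ ^ (-σ)) (𝓝[S] 0) (𝓝 0) := by
    have h : Continuous fun w : ℂ => ‖w‖ ^ (-σ) :=
      continuous_norm.rpow_const fun _ => Or.inr (by linarith [hσ.2])
    have := (h.tendsto 0).mono_left (nhdsWithin_le_nhds (s := S))
    rwa [norm_zero, Real.zero_rpow (by linarith [hσ.2])] at this
  have h2 := (isBigO_refl (fun w : ℂ => ‖w‖ ^ (σ + 1)) (𝓝[S] 0)).mul_isLittleO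
    ((isLittleO_one_iff ℝ).mpr h1)
  refine (h2.congr_left fun w => ?_).congr_right fun w => mul_one _
  -- This form also covers `w = 0`, since the exponents add up to `1 ≠ 0`.
  rw [← Real.rpow_add' (norm_nonneg w) (by norm_num)]
  ring_nf
  exact Real.rpow_one _

/-- Away from the singularity the logarithmic kernel is `O(w)`. -/
theorem integral_log_kernel_far {S : Set ℝ} (hS : MeasurableSet S) {δ : ℝ} (hδ : 0 < δ)
    (hSδ : ∀ t ∈ S, δ ≤ t) {f : ℝ → ℝ} (hf : AEStronglyMeasurable f (volume.restrict S))
    (hfi : IntegrableOn (fun t => f t / t) S) {w : ℂ} (hw : 2 * ‖w‖ ≤ δ) :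
    IntegrableOn (fun t : ℝ => Complex.log (1 + w / t) * (f t : ℂ)) S ∧
      ‖∫ t in S, Complex.log (1 + w / t) * (f t : ℂ)‖ ≤ 3 / 2 * (∫ t in S, |f t / t|) * ‖w‖ := by
  have hb : ∀ᵐ t : ℝ ∂(volume.restrict S), ‖Complex.log (1 + w / t) * (f t : ℂ)‖
      ≤ 3 / 2 * ‖w‖ * |f t / t| := by
    filter_upwards [ae_restrict_mem hS] with t ht
    have ht0 : 0 < t := hδ.trans_le (hSδ t ht)
    rw [norm_mul, Complex.norm_real, Real.norm_eq_abs]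
    calc _ ≤ 3 / 2 * (‖w‖ / t) * |f t| := by
          gcongr
          exact norm_log_one_add_div_le_div ht0 (hw.trans (hSδ t ht))
      _ = _ := by rw [abs_div, abs_of_pos ht0]; ring
  have hm : AEStronglyMeasurable (fun t : ℝ => Complex.log (1 + w / t) * (f t : ℂ))
      (volume.restrict S) :=
    (Measurable.aestronglyMeasurable (by fun_prop)).mul
      (Complex.continuous_ofReal.comp_aestronglyMeasurable hf)
  have hi := hfi.abs.const_mul (3 / 2 * ‖w‖)
  refine ⟨Integrable.mono' hi hm hb, (norm_integral_le_of_norm_le hi hb).trans (le_of_eq ?_)⟩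
  rw [integral_const_mul]; ring

theorem integrableOn_div_of_le {S : Set ℝ} (hS : MeasurableSet S) {δ : ℝ} (hδ : 0 < δ)
    (hSδ : ∀ t ∈ S, δ ≤ t) {f : ℝ → ℝ} (hf : IntegrableOn f S) :
    IntegrableOn (fun t => f t / t) S := by
  have hm : AEStronglyMeasurable (fun t => f t * t⁻¹) (volume.restrict S) :=
    hf.aestronglyMeasurable.mul measurable_inv.aestronglyMeasurable
  refine Integrable.mono' (hf.abs.const_mul δ⁻¹) hm ?_
  filter_upwards [ae_restrict_mem hS] with t ht
  have ht0 : 0 < t := hδ.trans_le (hSδ t ht)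
  rw [norm_div, Real.norm_eq_abs, Real.norm_of_nonneg ht0.le, div_eq_inv_mul]
  exact mul_le_mul_of_nonneg_right (inv_anti₀ hδ (hSδ t ht)) (abs_nonneg _)

/-- Near the singularity, against a density dominated by `ε t ^ σ`. -/
theorem integral_log_kernel_near {σ c : ℝ} {w : ℂ}
    (hI : IntegrableOn (fun t : ℝ => Complex.log (1 + w / t) * ((t ^ σ : ℝ) : ℂ)) (Set.Ioi 0))
    (hc : ∫ t in Set.Ioi (0 : ℝ), ‖Complex.log (1 + w / t) * ((t ^ σ : ℝ) : ℂ)‖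
      ≤ c * ‖w‖ ^ (σ + 1)) {δ ε : ℝ} (hε : 0 ≤ ε) {f : ℝ → ℝ}
    (hf : AEStronglyMeasurable f (volume.restrict (Set.Ioc 0 δ)))
    (hfb : ∀ t ∈ Set.Ioc 0 δ, |f t| ≤ ε * t ^ σ) :
    IntegrableOn (fun t : ℝ => Complex.log (1 + w / t) * (f t : ℂ)) (Set.Ioc 0 δ) ∧
      ‖∫ t in Set.Ioc 0 δ, Complex.log (1 + w / t) * (f t : ℂ)‖ ≤ ε * c * ‖w‖ ^ (σ + 1) := by
  have hb : ∀ᵐ t : ℝ ∂(volume.restrict (Set.Ioc 0 δ)), ‖Complex.log (1 + w / t) * (f t : ℂ)‖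
      ≤ ε * ‖Complex.log (1 + w / t) * ((t ^ σ : ℝ) : ℂ)‖ := by
    filter_upwards [ae_restrict_mem measurableSet_Ioc] with t ht
    rw [norm_mul, norm_mul, Complex.norm_real, Complex.norm_real, Real.norm_eq_abs,
      Real.norm_of_nonneg (Real.rpow_nonneg ht.1.le σ)]
    calc _ ≤ ‖Complex.log (1 + w / t)‖ * (ε * t ^ σ) := by
          gcongr
          exact hfb t ht
      _ = _ := by ring
  have hm : AEStronglyMeasurable (fun t : ℝ => Complex.log (1 + w / t) * (f t : ℂ))
      (volume.restrict (Set.Ioc 0 δ)) :=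
    (Measurable.aestronglyMeasurable (by fun_prop)).mul
      (Complex.continuous_ofReal.comp_aestronglyMeasurable hf)
  have hi := (hI.mono_set (show Set.Ioc 0 δ ⊆ Set.Ioi 0 from Set.Ioc_subset_Ioi_self)).norm.const_mul ε
  refine ⟨Integrable.mono' hi hm hb, (norm_integral_le_of_norm_le hi hb).trans ?_⟩
  rw [integral_const_mul, mul_assoc]
  gcongr
  refine le_trans ?_ hc
  exact setIntegral_mono_set hI.norm (Eventually.of_forall fun t => norm_nonneg _)
    (Eventually.of_forall Set.Ioc_subset_Ioi_self)

theorem exists_abs_le_mul_rpow {σ : ℝ} {d : ℝ → ℝ}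
    (hd : d =O[𝓝[>] 0] fun t => |t| ^ (σ + 1)) {b : ℝ} (hb : 0 < b) {ε : ℝ} (hε : 0 < ε) :
    ∃ δ ∈ Set.Ioc 0 b, ∀ t ∈ Set.Ioc 0 δ, |d t| ≤ ε * t ^ σ := by
  obtain ⟨C, hC0, hC⟩ := hd.exists_pos
  rw [IsBigOWith, eventually_nhdsWithin_iff] at hC
  obtain ⟨η, hη, hC⟩ := Metric.eventually_nhds_iff.mp hC
  -- `η/2` keeps the closed endpoint inside the neighbourhood of the `O`-bound; `t ≤ ε/C` turns `C t
  -- · t^σ` into at most `ε t^σ`.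
  refine ⟨min b (min (η / 2) (ε / C)), ⟨by positivity, min_le_left _ _⟩, fun t ht => ?_⟩
  have ht1 : t ≤ η / 2 := ht.2.trans ((min_le_right _ _).trans (min_le_left _ _))
  have ht2 : t ≤ ε / C := ht.2.trans ((min_le_right _ _).trans (min_le_right _ _))
  have h := hC (y := t) (by rw [Real.dist_0_eq_abs, abs_of_pos ht.1]; linarith) ht.1
  rw [Real.norm_eq_abs, Real.norm_of_nonneg (by positivity), abs_of_pos ht.1,
    Real.rpow_add_one ht.1.ne'] at h
  have h3 := Real.rpow_nonneg ht.1.le σ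
  calc |d t| ≤ C * (t ^ σ * t) := h
    _ = (C * t) * t ^ σ := by ring
    _ ≤ ε * t ^ σ := by
      gcongr
      rwa [le_div_iff₀ hC0, mul_comm] at ht2

/-- For each `ε` the integral is cut at a `δ` below which `|d| ≤ ε t^σ`: the near part scales like
`ε |w|^{σ+1}`, and the far part is `O(w)` with a constant depending on `ε`. -/
theorem integral_log_kernel_remainder {σ : ℝ} (hσ : σ ∈ Set.Ioo (-1 : ℝ) 0) {b : ℝ} (hb : 0 < b)
    {d : ℝ → ℝ} (hdi : IntegrableOn d (Set.Ioc 0 b))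
    (hd : d =O[𝓝[>] 0] fun t => |t| ^ (σ + 1)) :
    (∃ r > 0, ∀ w : ℂ, w ≠ 0 → ‖w‖ < r →
      IntegrableOn (fun t : ℝ => Complex.log (1 + w / t) * (d t : ℂ)) (Set.Ioc 0 b)) ∧
    (fun w : ℂ => ∫ t in Set.Ioc 0 b, Complex.log (1 + w / t) * (d t : ℂ))
      =o[𝓝[Complex.slitPlane] 0] fun w => ‖w‖ ^ (σ + 1) := by
  obtain ⟨c, hc⟩ := exists_integral_log_kernel_le hσ
  have key : ∀ ε > 0, ∃ δ > 0, ∃ K : ℝ, ∀ w : ℂ, w ≠ 0 → 2 * ‖w‖ ≤ δ →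
      IntegrableOn (fun t : ℝ => Complex.log (1 + w / t) * (d t : ℂ)) (Set.Ioc 0 b) ∧
      ‖∫ t in Set.Ioc 0 b, Complex.log (1 + w / t) * (d t : ℂ)‖
        ≤ ε * c * ‖w‖ ^ (σ + 1) + K * ‖w‖ := by
    intro ε hε
    obtain ⟨δ, hδ, hdδ⟩ := exists_abs_le_mul_rpow hd hb hε
    refine ⟨δ, hδ.1, 3 / 2 * ∫ t in Set.Ioc δ b, |d t / t|, fun w hw hwδ => ?_⟩
    have hsub : Set.Ioc δ b ⊆ Set.Ioc 0 b := Set.Ioc_subset_Ioc_left hδ.1.le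
    have hn := integral_log_kernel_near (hc w hw).1 (hc w hw).2 hε.le
      ((hdi.mono_set (Set.Ioc_subset_Ioc_right hδ.2)).aestronglyMeasurable) hdδ
    have hf := integral_log_kernel_far measurableSet_Ioc hδ.1 (fun t ht => ht.1.le)
      (hdi.mono_set hsub).aestronglyMeasurable
      (integrableOn_div_of_le measurableSet_Ioc hδ.1 (fun t ht => ht.1.le) (hdi.mono_set hsub)) hwδ
    rw [← Set.Ioc_union_Ioc_eq_Ioc hδ.1.le hδ.2]
    refine ⟨hn.1.union hf.1, ?_⟩
    rw [setIntegral_union (Set.Ioc_disjoint_Ioc_of_le le_rfl) measurableSet_Ioc hn.1 hf.1]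
    exact (norm_add_le _ _).trans (add_le_add hn.2 hf.2)
  constructor
  · obtain ⟨δ, hδ, K, h⟩ := key 1 one_pos
    exact ⟨δ / 2, by positivity, fun w hw hwδ => (h w hw (by linarith)).1⟩
  · rw [isLittleO_iff]
    intro η hη
    -- Chosen so that `ε c ≤ η/2`; nothing is assumed about the sign of `c`.
    obtain ⟨δ, hδ, K, h⟩ := key (η / (2 * (|c| + 1))) (by positivity)
    have h2 := ((isLittleO_norm_rpow hσ Complex.slitPlane).const_mul_left K).def (half_pos hη)
    filter_upwards [h2, self_mem_nhdsWithin,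
      mem_nhdsWithin_of_mem_nhds (Metric.ball_mem_nhds (0 : ℂ) (half_pos hδ))] with w h3 hw hwb
    rw [mem_ball_zero_iff] at hwb
    have h4 := (h w (Complex.slitPlane_ne_zero hw) (by linarith)).2
    have hp : 0 ≤ ‖w‖ ^ (σ + 1) := Real.rpow_nonneg (norm_nonneg w) _
    rw [Real.norm_eq_abs, Real.norm_of_nonneg hp] at h3
    rw [Real.norm_of_nonneg hp]
    have h5 : η / (2 * (|c| + 1)) * c ≤ η / 2 := by
      rw [div_mul_eq_mul_div, div_le_div_iff₀ (by positivity) two_pos]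
      nlinarith [le_abs_self c]
    have h6 := mul_le_mul_of_nonneg_right h5 hp
    have h7 := le_abs_self (K * ‖w‖)
    linarith

/-- The edge behaviour of the logarithmic transform of a density `A t ^ σ + O(t ^ (σ + 1))`. -/
theorem integral_log_kernel_expansion {σ : ℝ} (hσ : σ ∈ Set.Ioo (-1 : ℝ) 0) {b : ℝ} (hb : 0 < b)
    {ρ : ℝ → ℝ} {A : ℝ} (hρi : IntegrableOn ρ (Set.Ioc 0 b))
    (hρ : (fun t => ρ t - A * t ^ σ) =O[𝓝[>] 0] fun t => |t| ^ (σ + 1)) :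
    (∃ r > 0, ∀ w : ℂ, w ≠ 0 → ‖w‖ < r →
      IntegrableOn (fun t : ℝ => Complex.log (1 + w / t) * (ρ t : ℂ)) (Set.Ioc 0 b)) ∧
    (fun w : ℂ => (∫ t in Set.Ioc 0 b, Complex.log (1 + w / t) * (ρ t : ℂ))
        - A * logKernelIntegral σ 1 * w ^ ((σ + 1 : ℝ) : ℂ))
      =o[𝓝[Complex.slitPlane] 0] fun w => ‖w‖ ^ (σ + 1) := by
  obtain ⟨c, hc⟩ := exists_integral_log_kernel_le hσ
  have hdi : IntegrableOn (fun t => ρ t - A * t ^ σ) (Set.Ioc 0 b) :=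
    Integrable.sub hρi ((integrableOn_rpow_Ioc hσ.1 hb.le).const_mul A)
  obtain ⟨⟨r, hr0, hr⟩, ho⟩ := integral_log_kernel_remainder hσ hb hdi hρ
  have hI : ∀ w : ℂ, w ≠ 0 → IntegrableOn (fun t : ℝ => (A : ℂ) *
      (Complex.log (1 + w / t) * ((t ^ σ : ℝ) : ℂ))) (Set.Ioc 0 b) := fun w hw =>
    ((hc w hw).1.mono_set Set.Ioc_subset_Ioi_self).const_mul _
  have hsplit : ∀ (w : ℂ) (t : ℝ), Complex.log (1 + w / t) * (ρ t : ℂ)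
      = Complex.log (1 + w / t) * ((ρ t - A * t ^ σ : ℝ) : ℂ)
        + A * (Complex.log (1 + w / t) * ((t ^ σ : ℝ) : ℂ)) := by
    intro w t; push_cast; ring
  refine ⟨⟨r, hr0, fun w hw hwr => ?_⟩, ?_⟩
  · simp only [hsplit]
    exact Integrable.add (hr w hw hwr) (hI w hw)
  have hrp : IntegrableOn (fun t : ℝ => t ^ σ / t) (Set.Ioi b) := by
    refine (integrableOn_Ioi_rpow_of_lt (a := σ - 1) (by linarith [hσ.2]) hb).congr_fun
      (fun t ht => Real.rpow_sub_one (hb.trans ht).ne' σ) measurableSet_Ioi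
  -- Extending the pure power from `(0, b]` to the half-line costs only `O(w)`, because `t^{σ-1}` is
  -- integrable at infinity.
  have htail : (fun w : ℂ => (A : ℂ) * ∫ t in Set.Ioi b,
      Complex.log (1 + w / t) * ((t ^ σ : ℝ) : ℂ))
      =o[𝓝[Complex.slitPlane] 0] fun w => ‖w‖ ^ (σ + 1) := by
    refine IsLittleO.const_mul_left (IsBigO.trans_isLittleO ?_ (isLittleO_norm_rpow hσ _)) _
    refine IsBigO.of_bound (3 / 2 * ∫ t in Set.Ioi b, |t ^ σ / t|) ?_
    filter_upwards [mem_nhdsWithin_of_mem_nhds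
      (Metric.ball_mem_nhds (0 : ℂ) (half_pos hb))] with w hw
    rw [mem_ball_zero_iff] at hw
    rw [norm_norm]
    exact (integral_log_kernel_far measurableSet_Ioi hb (fun t ht => le_of_lt ht)
      (Measurable.aestronglyMeasurable (by fun_prop)) hrp (by linarith)).2
  refine (ho.sub htail).congr' ?_ EventuallyEq.rfl
  filter_upwards [self_mem_nhdsWithin,
    mem_nhdsWithin_of_mem_nhds (Metric.ball_mem_nhds (0 : ℂ) hr0)] with w hw hwr
  rw [mem_ball_zero_iff] at hwr
  have hw0 := Complex.slitPlane_ne_zero hw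
  simp only [hsplit w]
  rw [integral_add (hr w hw0 hwr) (hI w hw0), integral_const_mul, mul_assoc (A : ℂ),
    ← logKernelIntegral_eq_mul_cpow hσ hw, logKernelIntegral,
    ← Set.Ioc_union_Ioi_eq_Ioi hb.le, setIntegral_union Set.Ioc_disjoint_Ioi_same
      measurableSet_Ioi ((hc w hw0).1.mono_set Set.Ioc_subset_Ioi_self)
      ((hc w hw0).1.mono_set (Set.Ioi_subset_Ioi hb.le))]
  ring

/-! ### Correspondence between the slit plane and the complement of the arc. -/

/-- A point on the arc forces `w = θc - φ + 2πn`. For `n ≤ 0` this lies on the cut; for `n ≥ 1` it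
is at least the length of the complementary arc. -/
theorem edgePoint_mul_exp_notMem_zeroArc {θc θe : ℝ} {w : ℂ}
    (hw : w ∈ Complex.slitPlane) (hws : ‖w‖ < 2 * Real.pi - (θe - θc)) :
    edgePoint θc * Complex.exp (-(w * Complex.I)) ∉ zeroArc θc θe := by
  rintro ⟨φ, hφ, h⟩
  simp only [edgePoint, ← Complex.exp_add] at h
  obtain ⟨n, hn⟩ := Complex.exp_eq_exp_iff_exists_int.mp h
  have hw' : w = ((θc - φ + n * (2 * Real.pi) : ℝ) : ℂ) := by
    have : (w - ((θc - φ + n * (2 * Real.pi) : ℝ) : ℂ)) * Complex.I = 0 := by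
      push_cast; linear_combination hn
    exact sub_eq_zero.mp ((mul_eq_zero.mp this).resolve_right Complex.I_ne_zero)
  rw [hw', Complex.ofReal_mem_slitPlane] at hw
  rw [hw', Complex.norm_real, Real.norm_of_nonneg hw.le] at hws
  have hpi := Real.pi_pos
  rcases le_or_gt n 0 with h0 | h0
  · have : (n : ℝ) ≤ 0 := by exact_mod_cast h0
    nlinarith [hφ.1]
  · have : (1 : ℝ) ≤ n := by exact_mod_cast h0
    nlinarith [hφ.2]

theorem eventually_edgePoint_mul_exp_mem {θc θe : ℝ} (hθ' : θe < θc + 2 * Real.pi) {Ω : Set ℂ}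
    (hΩ : IsEdgeDomain θc θe Ω) :
    ∀ᶠ w in 𝓝[Complex.slitPlane] (0 : ℂ), edgePoint θc * Complex.exp (-(w * Complex.I)) ∈ Ω := by
  have ht : Tendsto (fun w : ℂ => edgePoint θc * Complex.exp (-(w * Complex.I)))
      (𝓝[Complex.slitPlane] 0) (𝓝[(zeroArc θc θe)ᶜ] (edgePoint θc)) := by
    refine tendsto_nhdsWithin_of_tendsto_nhds_of_eventually_within _ ?_ ?_
    · have h : Continuous fun w : ℂ => edgePoint θc * Complex.exp (-(w * Complex.I)) := by
        fun_prop
      have := (h.tendsto 0).mono_left (nhdsWithin_le_nhds (s := Complex.slitPlane))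
      simpa using this
    · filter_upwards [self_mem_nhdsWithin, mem_nhdsWithin_of_mem_nhds (Metric.ball_mem_nhds
        (0 : ℂ) (show 0 < 2 * Real.pi - (θe - θc) by linarith))] with w hw hwb
      exact edgePoint_mul_exp_notMem_zeroArc hw (mem_ball_zero_iff.mp hwb)
  exact ht.eventually hΩ.near_edge

theorem tendsto_edge_coordinate {θc θe : ℝ} (hθ : θc < θe) {Ω : Set ℂ}
    (hΩ : Disjoint Ω (zeroArc θc θe)) :
    Tendsto (fun z : ℂ => Complex.I * Complex.log (z * Complex.exp (-(θc * Complex.I))))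
      (𝓝[Ω] (edgePoint θc)) (𝓝[Complex.slitPlane] 0) ∧
    ∀ᶠ z in 𝓝[Ω] (edgePoint θc), edgePoint θc * Complex.exp
      (-(Complex.I * Complex.log (z * Complex.exp (-(θc * Complex.I))) * Complex.I)) = z := by
  have he : edgePoint θc * Complex.exp (-(θc * Complex.I)) = 1 := by
    rw [edgePoint, ← Complex.exp_add, add_neg_cancel, Complex.exp_zero]
  have hz0 : ∀ᶠ z in 𝓝[Ω] (edgePoint θc), z ≠ 0 :=
    (eventually_ne_nhds (Complex.exp_ne_zero _)).filter_mono nhdsWithin_le_nhds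
  have hinv : ∀ z : ℂ, z ≠ 0 → edgePoint θc * Complex.exp
      (-(Complex.I * Complex.log (z * Complex.exp (-(θc * Complex.I))) * Complex.I)) = z := by
    intro z hz
    rw [show -(Complex.I * Complex.log (z * Complex.exp (-(θc * Complex.I))) * Complex.I)
        = Complex.log (z * Complex.exp (-(θc * Complex.I))) by
      linear_combination -Complex.log (z * Complex.exp (-(θc * Complex.I))) * Complex.I_mul_I,
      Complex.exp_log (mul_ne_zero hz (Complex.exp_ne_zero _))]
    linear_combination z * he
  have hlim : Tendsto (fun z : ℂ => Complex.I * Complex.log (z * Complex.exp (-(θc * Complex.I))))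
      (𝓝[Ω] (edgePoint θc)) (𝓝 0) := by
    have hc : ContinuousAt (fun z : ℂ => Complex.I *
        Complex.log (z * Complex.exp (-(θc * Complex.I)))) (edgePoint θc) := by
      refine continuousAt_const.mul (ContinuousAt.clog (by fun_prop) ?_)
      rw [he]; exact Complex.one_mem_slitPlane
    have := hc.tendsto.mono_left (nhdsWithin_le_nhds (s := Ω))
    rwa [he, Complex.log_one, mul_zero] at this
  refine ⟨tendsto_nhdsWithin_of_tendsto_nhds_of_eventually_within _ hlim ?_, hz0.mono hinv⟩
  have hsm := hlim.norm
  rw [norm_zero] at hsm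
  filter_upwards [hz0, self_mem_nhdsWithin, hsm.eventually_lt_const (sub_pos.mpr hθ)]
    with z hz hzΩ hzs
  have h := hinv z hz
  generalize Complex.I * Complex.log (z * Complex.exp (-(θc * Complex.I))) = w at *
  by_contra hw
  rw [Complex.mem_slitPlane_iff, not_or, not_lt, not_not] at hw
  obtain ⟨s, rfl⟩ : ∃ s : ℝ, w = s := ⟨w.re, Complex.ext rfl hw.2⟩
  rw [Complex.ofReal_re] at hw
  rw [Complex.norm_real, Real.norm_of_nonpos hw.1] at hzs
  -- A value `s ≤ 0` on the cut with `|s| < θe - θc` would place `z` on the arc at angle `θc - s`.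
  refine Set.disjoint_left.mp hΩ hzΩ ⟨θc - s, ⟨by linarith, by linarith⟩, ?_⟩
  change Complex.exp (((θc - s : ℝ) : ℂ) * Complex.I) = z
  rw [← h, edgePoint, ← Complex.exp_add]
  congr 1
  push_cast
  ring

theorem setIntegral_Icc_eq_setIntegral_Ioc_shift {a b : ℝ} (hab : a ≤ b) (f : ℝ → ℂ) :
    ∫ φ in Set.Icc a b, f φ = ∫ t in Set.Ioc 0 (b - a), f (a + t) := by
  rw [integral_Icc_eq_integral_Ioc, ← intervalIntegral.integral_of_le hab,
    ← intervalIntegral.integral_of_le (sub_nonneg.mpr hab),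
    intervalIntegral.integral_comp_add_left (fun x => f x) a]
  simp

theorem integrableOn_Ioc_shift {E : Type*} [NormedAddCommGroup E] {a b : ℝ} (hab : a ≤ b)
    {f : ℝ → E} (hf : IntegrableOn f (Set.Icc a b)) :
    IntegrableOn (fun t => f (a + t)) (Set.Ioc 0 (b - a)) := by
  have h := ((intervalIntegrable_iff_integrableOn_Icc_of_le hab).mpr hf).comp_add_left a
  rw [sub_self, intervalIntegrable_iff_integrableOn_Ioc_of_le (sub_nonneg.mpr hab)] at h
  exact h

/-! ### Expansion of `F` in the edge coordinate. -/

/-- Near the edge each branch is a constant plus the model kernel. -/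
theorem IsLogRatioBranch.sub_eq_sub_of_model {Ω : Set ℂ} {z₀ zc : ℂ} {t : ℝ}
    (ht : 0 < t) {ℓ : ℂ → ℂ} (hℓ : IsLogRatioBranch Ω z₀ (zc * Complex.exp (t * Complex.I)) ℓ)
    {E : ℂ → ℂ} {r : ℝ} (hr : 0 < r) (hE : DifferentiableOn ℂ E (Metric.ball 0 r))
    (hexp : ∀ w ∈ Metric.ball 0 r, Complex.exp (-(w * Complex.I)) - Complex.exp (t * Complex.I)
      = (1 - Complex.exp (t * Complex.I)) * (1 + w / t) * Complex.exp (E w))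
    (hΩ : ∀ w ∈ Metric.ball 0 r ∩ Complex.slitPlane, zc * Complex.exp (-(w * Complex.I)) ∈ Ω)
    {v w : ℂ} (hv : v ∈ Metric.ball 0 r ∩ Complex.slitPlane)
    (hw : w ∈ Metric.ball 0 r ∩ Complex.slitPlane) :
    ℓ (zc * Complex.exp (-(v * Complex.I))) - (Complex.log (1 + v / t) + E v)
      = ℓ (zc * Complex.exp (-(w * Complex.I))) - (Complex.log (1 + w / t) + E w) := by
  -- The ball and the slit plane are both star-shaped about `r/2`, so their intersection is
  -- connected; the centre 0 is not available.
  have hmem : ((r / 2 : ℝ) : ℂ) ∈ Metric.ball 0 r ∩ Complex.slitPlane := by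
    refine ⟨?_, Complex.ofReal_mem_slitPlane.mpr (half_pos hr)⟩
    rw [mem_ball_zero_iff, Complex.norm_real, Real.norm_of_nonneg (half_pos hr).le]
    linarith
  have hpre : IsPreconnected (Metric.ball (0 : ℂ) r ∩ Complex.slitPlane) :=
    ((((convex_ball (0 : ℂ) r).starConvex hmem.1).inter
      (Complex.starConvex_ofReal_slitPlane (half_pos hr))).isPathConnected
        hmem).isConnected.isPreconnected
  refine sub_eq_sub_of_exp_eq_mul_exp (Metric.isOpen_ball.inter Complex.isOpen_slitPlane) hpre
    (f := fun w => ℓ (zc * Complex.exp (-(w * Complex.I))))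
    (g := fun w => Complex.log (1 + w / t) + E w)
    (k := zc * (1 - Complex.exp (t * Complex.I)) / (z₀ - zc * Complex.exp (t * Complex.I)))
    ?_ ?_ ?_ hv hw
  · exact hℓ.differentiableOn.comp (Differentiable.differentiableOn (by fun_prop)) hΩ
  · refine DifferentiableOn.add (fun u hu => ?_) (hE.mono Set.inter_subset_left)
    exact (DifferentiableAt.clog (f := fun u : ℂ => 1 + u / t) (by fun_prop)
      (one_add_div_mem_slitPlane hu.2 ht)).differentiableWithinAt
  · intro u hu
    rw [hℓ.exp_eq _ (hΩ u hu), Complex.exp_add, Complex.exp_log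
      (Complex.slitPlane_ne_zero (one_add_div_mem_slitPlane hu.2 ht)), ← mul_sub, hexp u hu.1]
    ring

theorem stieltjes_expansion_edge_coordinate {θc θe σ A : ℝ} (hθ : θc < θe)
    (hθ' : θe < θc + 2 * Real.pi) (hσ : σ ∈ Set.Ioo (-1 : ℝ) 0) {Ω : Set ℂ}
    (hΩ : IsEdgeDomain θc θe Ω) {F : ℂ → ℂ} {C : ℂ} {ρ : ℝ → ℝ}
    (hF : HasStieltjesRep F C ρ θc θe Ω)
    (hρ : (fun θ => ρ θ - A * (θ - θc) ^ σ) =O[𝓝[>] θc] fun θ => |θ - θc| ^ (σ + 1)) :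
    ∃ Fc : ℂ, (fun w : ℂ => F (edgePoint θc * Complex.exp (-(w * Complex.I))) - Fc
        - 1 / (2 * Real.pi) * (A * logKernelIntegral σ 1 * w ^ ((σ + 1 : ℝ) : ℂ)))
      =o[𝓝[Complex.slitPlane] 0] fun w => ‖w‖ ^ (σ + 1) := by
  obtain ⟨hρi, z₀, hz₀, L, hL, hrep⟩ := hF
  have hb : 0 < θe - θc := sub_pos.mpr hθ
  have hρi' := integrableOn_Ioc_shift hθ.le hρi
  have hρ' : (fun t => ρ (θc + t) - A * t ^ σ) =O[𝓝[>] 0] fun t => |t| ^ (σ + 1) := by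
    have ht : Tendsto (fun t : ℝ => θc + t) (𝓝[>] 0) (𝓝[>] θc) := by
      refine tendsto_nhdsWithin_of_tendsto_nhds_of_eventually_within _ ?_ ?_
      · have := ((continuous_const.add continuous_id).tendsto (0 : ℝ) :
          Tendsto (fun t : ℝ => θc + t) _ _).mono_left (nhdsWithin_le_nhds (s := Set.Ioi 0))
        simpa using! this
      · filter_upwards [self_mem_nhdsWithin] with t ht
        have : 0 < t := ht
        simpa using! this
    simpa [Function.comp_def] using! hρ.comp_tendsto ht
  obtain ⟨⟨r₁, hr₁, hi₁⟩, hmain⟩ := integral_log_kernel_expansion hσ hb hρi' hρ'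
  obtain ⟨E, r₂, hr₂, M, hEd, hEc, hEM, hEe⟩ :=
    exists_arc_log_remainder (b := θe - θc) (by linarith)
  obtain ⟨r₃, hr₃, hr₃Ω⟩ := Metric.mem_nhdsWithin_iff.mp
    (eventually_edgePoint_mul_exp_mem hθ' hΩ)
  obtain ⟨r, hr, hle₁, hle₂, hle₃⟩ : ∃ r > 0, r ≤ r₁ ∧ r ≤ r₂ ∧ r ≤ r₃ :=
    ⟨min r₁ (min r₂ r₃), by positivity, min_le_left _ _,
      (min_le_right _ _).trans (min_le_left _ _), (min_le_right _ _).trans (min_le_right _ _)⟩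
  set V := Metric.ball (0 : ℂ) r ∩ Complex.slitPlane with hV
  set Z : ℂ → ℂ := fun w => edgePoint θc * Complex.exp (-(w * Complex.I)) with hZ
  have hZΩ : ∀ w ∈ V, Z w ∈ Ω := fun w hw =>
    hr₃Ω ⟨Metric.ball_subset_ball hle₃ hw.1, hw.2⟩
  have hadd : ∀ t : ℝ, Complex.exp (((θc + t : ℝ) : ℂ) * Complex.I)
      = edgePoint θc * Complex.exp (t * Complex.I) := fun t => by
    rw [edgePoint, ← Complex.exp_add]; push_cast; congr 1; ring
  have hmodel : ∀ t ∈ Set.Ioc 0 (θe - θc), ∀ v ∈ V, ∀ w ∈ V,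
      L (θc + t) (Z v) - (Complex.log (1 + v / t) + E t v)
        = L (θc + t) (Z w) - (Complex.log (1 + w / t) + E t w) := by
    intro t ht v hv w hw
    have hl := hL (θc + t) ⟨by linarith [ht.1], by linarith [ht.2]⟩
    rw [hadd] at hl
    exact hl.sub_eq_sub_of_model ht.1 hr
      ((hEd t (Set.Ioc_subset_Icc_self ht)).mono (Metric.ball_subset_ball hle₂))
      (fun w hw => hEe t ht w (Metric.ball_subset_ball hle₂ hw)) hZΩ hv hw
  have iL : ∀ w ∈ V, IntegrableOn (fun t => L (θc + t) (Z w) * (ρ (θc + t) : ℂ))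
      (Set.Ioc 0 (θe - θc)) := by
    intro w hw
    -- The representation does not postulate measurability of the branches in `φ`; it comes from
    -- continuity in the pole.
    have hc : ContinuousOn (fun φ => L φ (Z w)) (Set.Icc θc θe) :=
      continuousOn_logRatioBranch hΩ.isOpen hΩ.isConnected.isPreconnected hz₀
        (a := fun φ : ℝ => Complex.exp (φ * Complex.I)) (by fun_prop)
        (fun φ hφ h => Set.disjoint_left.mp hΩ.disjoint_arc h ⟨φ, hφ, rfl⟩) hL (hZΩ w hw)
    exact integrableOn_Ioc_shift hθ.le
      (f := fun φ => L φ (Z w) * (ρ φ : ℂ))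
      (IntegrableOn.continuousOn_mul hc (Integrable.ofReal hρi) isCompact_Icc)
  have ilog : ∀ w ∈ V, IntegrableOn (fun t : ℝ => Complex.log (1 + w / t) * (ρ (θc + t) : ℂ))
      (Set.Ioc 0 (θe - θc)) := fun w hw => hi₁ w (Complex.slitPlane_ne_zero hw.2)
    ((mem_ball_zero_iff.mp hw.1).trans_le hle₁)
  have iE : ∀ w ∈ V, IntegrableOn (fun t : ℝ => E t w * (ρ (θc + t) : ℂ))
      (Set.Ioc 0 (θe - θc)) := by
    intro w hw
    rw [← integrableOn_Icc_iff_integrableOn_Ioc]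
    rw [← integrableOn_Icc_iff_integrableOn_Ioc] at hρi'
    exact IntegrableOn.continuousOn_mul (hEc w (Metric.ball_subset_ball hle₂ hw.1))
      (Integrable.ofReal hρi') isCompact_Icc
  have hv : ((r / 2 : ℝ) : ℂ) ∈ V := by
    refine ⟨?_, Complex.ofReal_mem_slitPlane.mpr (half_pos hr)⟩
    rw [mem_ball_zero_iff, Complex.norm_real, Real.norm_of_nonneg (half_pos hr).le]
    linarith
  set v : ℂ := ((r / 2 : ℝ) : ℂ) with hvdef
  -- The `w`-independent part of the integrand is evaluated at the reference point `v`, where it is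
  -- a combination of three integrable functions.
  set c : ℝ → ℂ := fun t => L (θc + t) (Z v) * (ρ (θc + t) : ℂ)
    - (Complex.log (1 + v / t) * (ρ (θc + t) : ℂ) + E t v * (ρ (θc + t) : ℂ)) with hc
  have ic : IntegrableOn c (Set.Ioc 0 (θe - θc)) :=
    Integrable.sub (iL v hv) (Integrable.add (ilog v hv) (iE v hv))
  have hFw : ∀ w ∈ V, F (Z w) - (C + 1 / (2 * Real.pi) * ∫ t in Set.Ioc 0 (θe - θc), c t)
      = 1 / (2 * Real.pi) * ((∫ t in Set.Ioc 0 (θe - θc),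
          Complex.log (1 + w / t) * (ρ (θc + t) : ℂ))
        + ∫ t in Set.Ioc 0 (θe - θc), E t w * (ρ (θc + t) : ℂ)) := by
    intro w hw
    have h1 : ∫ t in Set.Ioc 0 (θe - θc), L (θc + t) (Z w) * (ρ (θc + t) : ℂ)
        = ∫ t in Set.Ioc 0 (θe - θc), (c t + (Complex.log (1 + w / t) * (ρ (θc + t) : ℂ)
          + E t w * (ρ (θc + t) : ℂ))) := by
      refine setIntegral_congr_fun measurableSet_Ioc fun t ht => ?_
      have := hmodel t ht v hv w hw
      simp only [hc]
      linear_combination -(ρ (θc + t) : ℂ) * this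
    have h2 := hrep (Z w) (hZΩ w hw)
    have i2 : IntegrableOn (fun t : ℝ => Complex.log (1 + w / t) * (ρ (θc + t) : ℂ)
        + E t w * (ρ (θc + t) : ℂ)) (Set.Ioc 0 (θe - θc)) := Integrable.add (ilog w hw) (iE w hw)
    rw [setIntegral_Icc_eq_setIntegral_Ioc_shift hθ.le, h1,
      integral_add ic i2,
      integral_add (ilog w hw) (iE w hw)] at h2
    linear_combination h2
  have hEo : (fun w : ℂ => ∫ t in Set.Ioc 0 (θe - θc), E t w * (ρ (θc + t) : ℂ))
      =o[𝓝[Complex.slitPlane] 0] fun w => ‖w‖ ^ (σ + 1) := by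
    refine IsBigO.trans_isLittleO ?_ (isLittleO_norm_rpow hσ _)
    refine IsBigO.of_bound (M * ∫ t in Set.Ioc 0 (θe - θc), |ρ (θc + t)|) ?_
    filter_upwards [mem_nhdsWithin_of_mem_nhds (Metric.ball_mem_nhds (0 : ℂ) hr₂)] with w hw
    rw [norm_norm]
    refine (norm_integral_le_of_norm_le (hρi'.abs.const_mul (M * ‖w‖)) ?_).trans (le_of_eq ?_)
    · filter_upwards [ae_restrict_mem measurableSet_Ioc] with t ht
      rw [norm_mul, Complex.norm_real, Real.norm_eq_abs]
      gcongr
      exact hEM t (Set.Ioc_subset_Icc_self ht) w hw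
    · rw [integral_const_mul]; ring
  refine ⟨C + 1 / (2 * Real.pi) * ∫ t in Set.Ioc 0 (θe - θc), c t,
    ((hmain.add hEo).const_mul_left (1 / (2 * Real.pi) : ℂ)).congr' ?_ EventuallyEq.rfl⟩
  filter_upwards [inter_mem (mem_nhdsWithin_of_mem_nhds (Metric.ball_mem_nhds (0 : ℂ) hr))
    self_mem_nhdsWithin] with w hw
  rw [hFw w hw]
  ring

/-! ### The coefficient and the return to the variable `z`. -/

/-- To leading order `edgePow` is this exponential times `w^{σ+1}`, so the identity matches the
coefficients of `w^{σ+1}`. -/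
theorem edgeCoeff_mul_exp {A σ θc : ℝ} (hσ : σ ∈ Set.Ioo (-1 : ℝ) 0) :
    edgeCoeff A σ θc * Complex.exp (((σ + 1 : ℝ) : ℂ) * (θc * Complex.I - Real.pi / 2 * Complex.I))
      = 1 / (2 * Real.pi) * (A * logKernelIntegral σ 1) := by
  have h1 : Complex.exp (Complex.I * Real.pi * σ / 2) * Complex.exp (-(Complex.I * θc * (σ + 1))) *
      Complex.exp (((σ + 1 : ℝ) : ℂ) * (θc * Complex.I - Real.pi / 2 * Complex.I))
      = -Complex.I := by
    rw [← Complex.exp_add, ← Complex.exp_add, ← Complex.exp_neg_pi_div_two_mul_I]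
    congr 1
    push_cast
    ring
  have hpi : (Real.pi : ℂ) ≠ 0 := by exact_mod_cast Real.pi_ne_zero
  rw [logKernelIntegral_one hσ, edgeCoeff, div_mul_eq_mul_div, mul_assoc (A : ℂ), mul_assoc (A : ℂ),
    h1]
  have h2 : ((σ : ℂ) + 1) ≠ 0 := by exact_mod_cast (by linarith [hσ.1] : (0 : ℝ) < σ + 1).ne'
  -- If the sine vanished, both sides would be 0 under the convention for division by zero.
  by_cases h3 : (Real.sin (Real.pi * σ) : ℂ) = 0
  · simp [h3]
  · field_simp

theorem sin_pi_mul_neg {σ : ℝ} (hσ : σ ∈ Set.Ioo (-1 : ℝ) 0) : Real.sin (Real.pi * σ) < 0 :=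
  Real.sin_neg_of_neg_of_neg_pi_lt (mul_neg_of_pos_of_neg Real.pi_pos hσ.2)
    (by nlinarith [Real.pi_pos, hσ.1])

theorem norm_edgeCoeff {A σ θc : ℝ} (hA : 0 < A) (hσ : σ ∈ Set.Ioo (-1 : ℝ) 0) :
    ‖edgeCoeff A σ θc‖ = A / (2 * (σ + 1) * |Real.sin (Real.pi * σ)|) := by
  have h1 : Complex.I * Real.pi * σ / 2 = ((Real.pi * σ / 2 : ℝ) : ℂ) * Complex.I := by
    push_cast; ring
  have h2 : -(Complex.I * θc * (σ + 1)) = ((-(θc * (σ + 1)) : ℝ) : ℂ) * Complex.I := by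
    push_cast; ring
  have h3 : ((σ : ℂ) + 1) = ((σ + 1 : ℝ) : ℂ) := by push_cast; rfl
  rw [edgeCoeff, h1, h2, h3, norm_div, norm_mul, norm_mul, norm_mul, norm_mul, norm_mul,
    Complex.norm_exp_ofReal_mul_I, Complex.norm_exp_ofReal_mul_I, Complex.norm_real,
    Complex.norm_real, Complex.norm_real, Complex.norm_I, Complex.norm_two,
    Real.norm_of_nonneg hA.le, Real.norm_of_nonneg (by linarith [hσ.1] : 0 ≤ σ + 1),
    Real.norm_eq_abs]
  ring

/-- The two terms differ by the relative factor `exp ((σ+1) lam w) - 1`, which tends to 0. -/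
theorem edgePow_sub_isLittleO {A σ : ℝ} (θc : ℝ) (hσ : σ ∈ Set.Ioo (-1 : ℝ) 0) :
    (fun w : ℂ => edgeCoeff A σ θc *
        edgePow θc (σ + 1) (edgePoint θc * Complex.exp (-(w * Complex.I)))
        - 1 / (2 * Real.pi) * (A * logKernelIntegral σ 1 * w ^ ((σ + 1 : ℝ) : ℂ)))
      =o[𝓝[Complex.slitPlane] 0] fun w => ‖w‖ ^ (σ + 1) := by
  obtain ⟨lam, hlam, hlog⟩ := exists_edgeLog_eq θc
  have h1 : Tendsto (fun w => Complex.exp (((σ + 1 : ℝ) : ℂ) * lam w) - 1)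
      (𝓝[Complex.slitPlane] 0) (𝓝 0) := by
    have h := (((hlam.const_mul ((σ + 1 : ℝ) : ℂ)).cexp).sub_const 1).mono_left
      (nhdsWithin_le_nhds (s := Complex.slitPlane))
    simpa using h
  have h2 : (fun w : ℂ => w ^ ((σ + 1 : ℝ) : ℂ)) =O[𝓝[Complex.slitPlane] 0]
      fun w => ‖w‖ ^ (σ + 1) := by
    refine IsBigO.of_bound 1 (Eventually.of_forall fun w => ?_)
    rw [Complex.norm_cpow_real, one_mul, Real.norm_of_nonneg (Real.rpow_nonneg (norm_nonneg w) _)]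
  have h3 := (h2.mul_isLittleO ((isLittleO_one_iff ℝ).mpr h1)).const_mul_left
    (1 / (2 * Real.pi) * (A * logKernelIntegral σ 1))
  refine (h3.congr' ?_ (Eventually.of_forall fun w => mul_one _))
  filter_upwards [self_mem_nhdsWithin, hlog.filter_mono nhdsWithin_le_nhds] with w hw hl
  rw [edgePow, hl hw, ← edgeCoeff_mul_exp (θc := θc) hσ,
    Complex.cpow_def_of_ne_zero (Complex.slitPlane_ne_zero hw),
    show ((σ + 1 : ℝ) : ℂ) * (θc * Complex.I + (Complex.log w - Real.pi / 2 * Complex.I + lam w))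
      = ((σ + 1 : ℝ) : ℂ) * (θc * Complex.I - Real.pi / 2 * Complex.I)
        + Complex.log w * ((σ + 1 : ℝ) : ℂ) + ((σ + 1 : ℝ) : ℂ) * lam w by ring,
    Complex.exp_add, Complex.exp_add, ← mul_assoc (1 / (2 * Real.pi) : ℂ),
    ← edgeCoeff_mul_exp (θc := θc) hσ]
  ring

/-- The coordinate map has nonzero derivative at 0, so `|w| = O(|z - z_c|)`. -/
theorem rpow_norm_isBigO_edge {σ : ℝ} (hσ : -1 < σ) (θc : ℝ) (S : Set ℂ) :
    (fun w : ℂ => ‖w‖ ^ (σ + 1)) =O[𝓝[S] 0]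
      fun w => ‖edgePoint θc * Complex.exp (-(w * Complex.I)) - edgePoint θc‖ ^ (σ + 1) := by
  have hd : HasDerivAt (fun w : ℂ => edgePoint θc * Complex.exp (-(w * Complex.I)))
      (edgePoint θc * (Complex.exp (-(0 * Complex.I)) * (-(1 * Complex.I)))) 0 :=
    (((hasDerivAt_id (0 : ℂ)).mul_const Complex.I).neg.cexp).const_mul _
  have hne : edgePoint θc * (Complex.exp (-(0 * Complex.I)) * (-(1 * Complex.I))) ≠ 0 := by
    simp [edgePoint, Complex.exp_ne_zero]
  have ht : Tendsto (fun w : ℂ => (w, (0 : ℂ))) (𝓝[S] 0) (𝓝 0 ×ˢ pure 0) :=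
    (tendsto_id.mono_left nhdsWithin_le_nhds).prodMk 
      (tendsto_pure.mpr (Eventually.of_forall fun _ => rfl))
  have h := ((hd.isTheta_sub hne).isBigO_symm.comp_tendsto ht).norm_norm
  have h' := h.rpow (by linarith : 0 ≤ σ + 1) (Eventually.of_forall fun w => norm_nonneg _)
  simpa [Function.comp_def] using h'

theorem mainTheorem3 (θc θe σ A : ℝ) (hθ : θc < θe) (hθ' : θe < θc + 2 * Real.pi)
    (hσ : σ ∈ Set.Ioo (-1 : ℝ) 0) (hA : 0 < A)
    (Ω : Set ℂ) (hΩ : IsEdgeDomain θc θe Ω)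
    (F : ℂ → ℂ) (C : ℂ) (ρ : ℝ → ℝ) (hF : HasStieltjesRep F C ρ θc θe Ω)
    (hρ : (fun θ => ρ θ - A * (θ - θc) ^ σ) =O[𝓝[>] θc] fun θ => |θ - θc| ^ (σ + 1)) :
    (∃ Fc : ℂ, HasEdgeExpansion F Ω θc σ Fc (edgeCoeff A σ θc)) ∧
      ‖edgeCoeff A σ θc‖ = A / (2 * (σ + 1) * |Real.sin (Real.pi * σ)|) ∧
      ‖edgeCoeff A σ θc‖ ≠ 0 := by
  have hs1 : 0 < σ + 1 := by linarith [hσ.1]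
  have hnorm := norm_edgeCoeff (θc := θc) hA hσ
  have hpos : ‖edgeCoeff A σ θc‖ ≠ 0 := by
    have := abs_pos.mpr (sin_pi_mul_neg hσ).ne
    rw [hnorm]
    positivity
  obtain ⟨Fc, hFc⟩ := stieltjes_expansion_edge_coordinate hθ hθ' hσ hΩ hF hρ
  obtain ⟨hw, hz⟩ := tendsto_edge_coordinate hθ hΩ.disjoint_arc
  have hexp : (fun z => F z - Fc - edgeCoeff A σ θc * edgePow θc (σ + 1) z)
      =o[𝓝[Ω] (edgePoint θc)] fun z => ‖z - edgePoint θc‖ ^ (σ + 1) := by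
    have h := ((hFc.sub (edgePow_sub_isLittleO (A := A) θc hσ)).trans_isBigO
      (rpow_norm_isBigO_edge hσ.1 θc _)).comp_tendsto hw
    refine h.congr' ?_ ?_
    · filter_upwards [hz] with z hz
      simp only [Function.comp_apply, hz]
      ring
    · filter_upwards [hz] with z hz
      simp only [Function.comp_apply, hz]
  have hzero : Tendsto (fun z => ‖z - edgePoint θc‖ ^ (σ + 1)) (𝓝[Ω] (edgePoint θc)) (𝓝 0) := by
    have hc : Continuous fun z => ‖z - edgePoint θc‖ ^ (σ + 1) :=
      (continuous_id.sub continuous_const).norm.rpow_const fun _ => Or.inr hs1.le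
    have := (hc.tendsto (edgePoint θc)).mono_left (nhdsWithin_le_nhds (s := Ω))
    rwa [sub_self, norm_zero, Real.zero_rpow hs1.ne'] at this
  -- The exponent is real, so `|edgePow|` is exactly `|z - z_c|^{σ+1}`.
  have hpow : Tendsto (fun z => edgePow θc (σ + 1) z) (𝓝[Ω] (edgePoint θc)) (𝓝 0) := by
    refine squeeze_zero_norm' ?_ hzero
    have hne : ∀ᶠ z in 𝓝[Ω] (edgePoint θc), z ≠ edgePoint θc := by
      filter_upwards [self_mem_nhdsWithin] with z hz h
      exact Set.disjoint_left.mp hΩ.disjoint_arc hz ⟨θc, ⟨le_rfl, hθ.le⟩, h.symm⟩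
    filter_upwards [hne] with z hz
    rw [edgePow, Complex.norm_exp, Complex.re_ofReal_mul, ← exp_edgeLog θc z hz, Complex.norm_exp,
      ← Real.exp_mul, mul_comm]
  refine ⟨⟨Fc, hσ, norm_ne_zero_iff.mp hpos, ?_, hexp⟩, hnorm, hpos⟩
  have h := ((hexp.trans_tendsto hzero).add (hpow.const_mul (edgeCoeff A σ θc))).add_const Fc
  refine (h.congr fun z => ?_).trans (by simp)
  ring
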